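/- **Proposition 2.4** (homotopy invariance of $B\mathcal C_\bullet$). Fix $d\ge 1$. Write $\mathbb R^\infty=\operatorname{colim}_n\mathbb R^n=\mathbb R\times\mathbb R^{d-1+\infty}$ (the first coordinate is called time), and let $BO(d)=\operatorname{colim}_n \mathrm{Gr}_d(\mathbb R^{n})$ be the Grassmannian of $d$-dimensional linear subspaces of $\mathbb R^{\infty}$. A *parametrized tangential structure* over a space $B$ is a (Hurewicz) fibration $\theta\colon X\to BO(d)\times B$. *The category $\mathcal C(\theta)$.* It is the following non-unital category. An object is $(E,p,a,l)$, where $a\in\mathbb R$; $p\colon E\to B$ is a fiber bundle of closed smooth $(d-1)$-manifolds, fiberwise smoothly embedded as a subset of $B\times\{a\}\times\mathbb R^{d-1+\infty}$ (and contained in $B\times\{a\}\times\mathbb R^{d-1+N}$, for some $N$, over each compact subset of $B$); and $l\colon E\to X$ is a continuous lift along $\theta$ of $(\epsilon\oplus T^vE,p)\colon E\to BO(d)\times B$, where $\epsilon$ is the time direction and $T^vE$ the vertical tangent space. A morphism from $(E_0,p_0,a_0,l_0)$ to $(E_1,p_1,a_1,l_1)$, $a_0<a_1$, is a fiber bundle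 $W\to B$ of compact smooth $d$-manifolds with boundary, fiberwise smoothly embedded as a subset of $B\times[a_0,a_1]\times\mathbb R^{d-1+\infty}$ (with the same condition over compact subsets of $B$), which locally over $B$ is a cylinder on $E_0$ near time $a_0$ and a cylinder on $E_1$ near time $a_1$, with fiberwise boundary $E_0\sqcup E_1$, together with a continuous lift $l_W\colon W\to X$ along $\theta$ of $(T^vW,\mathrm{proj})\colon W\to BO(d)\times B$ that restricts to $l_0$ and $l_1$. Composition is union of subsets of $B\times\mathbb R^{\infty}$. *Operations.* A map $g\colon\theta\to\eta$ over $BO(d)\times B$ induces the push-forward functor $g_*\colon\mathcal C(\theta)\to\mathcal C(\eta)$ by composing tangential structures with $g$. A pull-back square exhibiting $\theta'\colon X'\to BO(d)\times B'$ as the pull-back of $\theta$ along $\mathrm{id}\times f$, for a map $f\colon B'\to B$, induces the pull-back functor $f^*\colon\mathcal C(\theta)\to\mathcal C(\theta')$. These operations are functorial and commute with each other, so $\theta\mapsto\mathcal C(\theta)$ is a bivariant theory. Its simplicial thickening is $\mathcal C(\theta)_n=\mathcal C(\theta\times\mathrm{id}_{\Delta^n})$, a simplicial non-unital category, and $B\mathcal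 C(\theta)_\bullet$ is the fat geometric realization of $[n]\mapsto B(\mathcal C(\theta)_n)$, where the classifying space $B(-)$ of a non-unital category is the geometric realization of its nerve as a semi-simplicial set. The operations $g_*$ and $f^*$ extend to make $\theta\mapsto B\mathcal C(\theta)_\bullet$ a bivariant theory with values in spaces. **Claim.** The bivariant theory $\theta\mapsto B\mathcal C(\theta)_\bullet$ is homotopy invariant: (a) if $\theta\colon X\to BO(d)\times B$ and $\eta\colon Y\to BO(d)\times B$ are parametrized tangential structures over the same space $B$ and $g\colon X\to Y$ is a map over $BO(d)\times B$ that is a homotopy equivalence of total spaces, then $g_*\colon B\mathcal C(\theta)_\bullet\to B\mathcal C(\eta)_\bullet$ is a homotopy equivalence; (b) if $f\colon B'\to B$ is a homotopy equivalence and $\theta'$ is the pull-back of $\theta$ along $\mathrm{id}_{BO(d)}\times f$, then $f^*\colon B\mathcal C(\theta)_\bullet\to B\mathcal C(\theta')_\bullet$ is a homotopy equivalence. -/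

import Mathlib

open CategoryTheory Opposite Topology
open scoped Manifold ContDiff

universe u v w

noncomputable section

namespace ParamCob

/-! ## Euclidean space of infinite dimension, the Grassmannian, fibrations -/

/-- `ℝ^∞ = colim ℝ^n`, realized by finitely supported sequences. The coordinate `0` is the
"time" coordinate: `ℝ^∞ = ℝ^{d+∞} = ℝ × ℝ^{d-1+∞}`. -/
abbrev RInf : Type := ℕ →₀ ℝ

/-- The standard inclusion `ℝ^n → ℝ^∞`. -/
def RInf.incl (n : ℕ) : (Fin n → ℝ) →ₗ[ℝ] RInf :=
  (Finsupp.lmapDomain ℝ ℝ (fun i : Fin n => (i : ℕ))) ∘ₗ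
    (Finsupp.linearEquivFunOnFinite ℝ ℝ (Fin n)).symm.toLinearMap

theorem RInf.incl_injective (n : ℕ) : Function.Injective (RInf.incl n) :=
  (Finsupp.mapDomain_injective Fin.val_injective).comp
    (Finsupp.linearEquivFunOnFinite ℝ ℝ (Fin n)).symm.injective

/-- The colimit topology on `ℝ^∞ = colim ℝ^n`. -/
instance RInf.topology : TopologicalSpace RInf :=
  ⨆ n : ℕ, TopologicalSpace.coinduced (RInf.incl n) inferInstance

/-- `v` with its time coordinate replaced by `t`. -/
def RInf.setTime (v : RInf) (t : ℝ) : RInf := Finsupp.update v 0 t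

/-- `BO(d) = Gr_d(ℝ^∞)`, the set of `d`-dimensional linear subspaces of `ℝ^∞`. -/
def BO (d : ℕ) : Type := {V : Submodule ℝ RInf // Module.rank ℝ V = d}

/-- The `d`-dimensional subspace spanned by a `d`-frame in `ℝ^n`. -/
def BO.ofFrame (d n : ℕ) (v : {v : Fin d → (Fin n → ℝ) // LinearIndependent ℝ v}) : BO d :=
  ⟨Submodule.span ℝ (Set.range (fun i => RInf.incl n (v.1 i))), by
    have h : LinearIndependent ℝ (fun i => RInf.incl n (v.1 i)) :=
      v.2.map' (RInf.incl n) (LinearMap.ker_eq_bot.2 (RInf.incl_injective n))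
    rw [rank_span h, Cardinal.mk_range_eq _ h.injective, Cardinal.mk_fin]⟩

/-- The topology of `BO(d) = colim_n Gr_d(ℝ^n)`, where `Gr_d(ℝ^n)` is the quotient of the
(noncompact) Stiefel manifold of `d`-frames in `ℝ^n`. -/
instance BO.topology (d : ℕ) : TopologicalSpace (BO d) :=
  ⨆ n : ℕ, TopologicalSpace.coinduced (BO.ofFrame d n) inferInstance

/-- A (Hurewicz) fibration: the homotopy lifting property with respect to all spaces. -/
def IsFibration {E B : Type u} [TopologicalSpace E] [TopologicalSpace B] (π : C(E, B)) : Prop :=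
  ∀ (Y : Type u) [TopologicalSpace Y] (H : C(Y × unitInterval, B)) (h₀ : C(Y, E)),
    (∀ y, π (h₀ y) = H (y, 0)) →
      ∃ G : C(Y × unitInterval, E), (∀ z, π (G z) = H z) ∧ ∀ y, G (y, 0) = h₀ y

/-- `f` is (the underlying map of) a homotopy equivalence. -/
def IsHomotopyEquiv {X : Type v} {Y : Type w} [TopologicalSpace X] [TopologicalSpace Y]
    (f : C(X, Y)) : Prop :=
  ∃ e : ContinuousMap.HomotopyEquiv X Y, e.toFun = f

/-! ## Parametrized tangential structures -/

/-- A parametrized `d`-dimensional tangential structure over the space `B`: a fibration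
`X → BO(d) × B`. -/
structure TangentialStructure (d : ℕ) (B : Type u) [TopologicalSpace B] where
  X : Type u
  [top : TopologicalSpace X]
  map : C(X, BO d × B)
  fibration : IsFibration map

attribute [instance] TangentialStructure.top

/-- A fiberwise map `θ → η` over `BO(d) × B`. -/
@[ext]
structure PushMap {d : ℕ} {B : Type u} [TopologicalSpace B] (θ η : TangentialStructure d B) where
  map : C(θ.X, η.X)
  comm : ∀ x, η.map (map x) = θ.map x

namespace PushMap

variable {d : ℕ} {B : Type u} [TopologicalSpace B] {θ η ζ : TangentialStructure d B}

def id (θ : TangentialStructure d B) : PushMap θ θ := ⟨ContinuousMap.id _, fun _ => rfl⟩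

def comp (g : PushMap θ η) (h : PushMap η ζ) : PushMap θ ζ :=
  ⟨h.map.comp g.map, fun x => (h.comm _).trans (g.comm x)⟩

end PushMap

/-- A pull-back square
```
    X' -------F-------> X
    |                   |
    θ'                  θ
    v                   v
BO(d) × B' --id × f--> BO(d) × B .
```
-/
@[ext]
structure PullSquare {d : ℕ} {B' B : Type u} [TopologicalSpace B'] [TopologicalSpace B]
    (θ' : TangentialStructure d B') (θ : TangentialStructure d B) where
  f : C(B', B)
  F : C(θ'.X, θ.X)
  isPullback : IsPullback (TopCat.ofHom F) (TopCat.ofHom θ'.map) (TopCat.ofHom θ.map)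
    (TopCat.ofHom ((ContinuousMap.id (BO d)).prodMap f))

namespace PullSquare

variable {d : ℕ} {B B' B'' : Type u} [TopologicalSpace B] [TopologicalSpace B']
  [TopologicalSpace B''] {θ : TangentialStructure d B} {θ' : TangentialStructure d B'}
  {θ'' : TangentialStructure d B''}

theorem comm (p : PullSquare θ' θ) (x : θ'.X) :
    θ.map (p.F x) = ((θ'.map x).1, p.f (θ'.map x).2) :=
  congrArg (fun h => TopCat.Hom.hom h x) p.isPullback.w

theorem exists_lift (p : PullSquare θ' θ) {Z : Type u} [TopologicalSpace Z]
    (x : C(Z, θ.X)) (y : C(Z, BO d × B')) (h : ∀ z, θ.map (x z) = ((y z).1, p.f (y z).2)) :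
    ∃ l : C(Z, θ'.X), (∀ z, p.F (l z) = x z) ∧ ∀ z, θ'.map (l z) = y z := by
  obtain ⟨l, h₁, h₂⟩ := p.isPullback.exists_lift (TopCat.ofHom x) (TopCat.ofHom y)
    (TopCat.ext h)
  exact ⟨l.hom, fun z => congrArg (fun k => TopCat.Hom.hom k z) h₁,
    fun z => congrArg (fun k => TopCat.Hom.hom k z) h₂⟩

theorem point_ext (p : PullSquare θ' θ) {x y : θ'.X} (h₁ : p.F x = p.F y)
    (h₂ : θ'.map x = θ'.map y) : x = y := by
  have := p.isPullback.hom_ext (W := TopCat.of PUnit)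
    (k := TopCat.ofHom (ContinuousMap.const _ x)) (l := TopCat.ofHom (ContinuousMap.const _ y))
    (TopCat.ext fun _ => h₁) (TopCat.ext fun _ => h₂)
  exact congrArg (fun k => TopCat.Hom.hom k PUnit.unit) this

/-- The map to the pull-back determined by maps to `X` and to `BO(d) × B'`. -/
def lift (p : PullSquare θ' θ) {Z : Type u} [TopologicalSpace Z]
    (x : C(Z, θ.X)) (y : C(Z, BO d × B')) (h : ∀ z, θ.map (x z) = ((y z).1, p.f (y z).2)) :
    C(Z, θ'.X) :=
  (p.exists_lift x y h).choose

theorem F_lift (p : PullSquare θ' θ) {Z : Type u} [TopologicalSpace Z]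
    (x : C(Z, θ.X)) (y : C(Z, BO d × B')) (h : ∀ z, θ.map (x z) = ((y z).1, p.f (y z).2)) (z : Z) :
    p.F (p.lift x y h z) = x z :=
  (p.exists_lift x y h).choose_spec.1 z

theorem map_lift (p : PullSquare θ' θ) {Z : Type u} [TopologicalSpace Z]
    (x : C(Z, θ.X)) (y : C(Z, BO d × B')) (h : ∀ z, θ.map (x z) = ((y z).1, p.f (y z).2)) (z : Z) :
    θ'.map (p.lift x y h z) = y z :=
  (p.exists_lift x y h).choose_spec.2 z

def id (θ : TangentialStructure d B) : PullSquare θ θ :=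
  ⟨ContinuousMap.id _, ContinuousMap.id _, by
    have h₁ : TopCat.ofHom (ContinuousMap.id θ.X) = 𝟙 _ := rfl
    have h₂ : TopCat.ofHom ((ContinuousMap.id (BO d)).prodMap (ContinuousMap.id B)) = 𝟙 _ := rfl
    rw [h₁, h₂]
    exact IsPullback.of_id_fst⟩

/-- Horizontal pasting of pull-back squares. -/
def comp (q : PullSquare θ'' θ') (p : PullSquare θ' θ) : PullSquare θ'' θ :=
  ⟨p.f.comp q.f, p.F.comp q.F, q.isPullback.paste_horiz p.isPullback⟩

end PullSquare

/-! ## Bivariant theories -/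

/-- A bivariant theory with values in the category `A`, defined on the class of all parametrized
`d`-dimensional tangential structures. -/
structure BivariantTheory (d : ℕ) (A : Type v) [Category.{w} A] where
  obj : ∀ {B : Type u} [TopologicalSpace B], TangentialStructure d B → A
  push : ∀ {B : Type u} [TopologicalSpace B] {θ η : TangentialStructure d B},
    PushMap θ η → (obj θ ⟶ obj η)
  pull : ∀ {B' B : Type u} [TopologicalSpace B'] [TopologicalSpace B]
    {θ' : TangentialStructure d B'} {θ : TangentialStructure d B},
    PullSquare θ' θ → (obj θ ⟶ obj θ')
  push_id : ∀ {B : Type u} [TopologicalSpace B] (θ : TangentialStructure d B),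
    push (PushMap.id θ) = 𝟙 (obj θ)
  push_comp : ∀ {B : Type u} [TopologicalSpace B] {θ η ζ : TangentialStructure d B}
    (g : PushMap θ η) (h : PushMap η ζ), push (g.comp h) = push g ≫ push h
  pull_id : ∀ {B : Type u} [TopologicalSpace B] (θ : TangentialStructure d B),
    pull (PullSquare.id θ) = 𝟙 (obj θ)
  pull_comp : ∀ {B'' B' B : Type u} [TopologicalSpace B''] [TopologicalSpace B']
    [TopologicalSpace B] {θ'' : TangentialStructure d B''} {θ' : TangentialStructure d B'}
    {θ : TangentialStructure d B} (q : PullSquare θ'' θ') (p : PullSquare θ' θ),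
    pull (q.comp p) = pull p ≫ pull q
  push_pull : ∀ {B' B : Type u} [TopologicalSpace B'] [TopologicalSpace B]
    {θ' η' : TangentialStructure d B'} {θ η : TangentialStructure d B}
    (p : PullSquare θ' θ) (q : PullSquare η' η) (g : PushMap θ η) (g' : PushMap θ' η'),
    p.f = q.f → q.F.comp g'.map = g.map.comp p.F → push g ≫ pull q = pull p ≫ push g'

/-- A bivariant theory with values in spaces is homotopy invariant if
(a) `g_*` is a homotopy equivalence whenever `g : θ → η` is a homotopy equivalence between the
total spaces, and
(b) `f^*` is a homotopy equivalence whenever `f : B' → B` is a homotopy equivalence. -/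
structure BivariantTheory.IsHomotopyInvariant {d : ℕ}
    (F : BivariantTheory.{u} d TopCat.{v}) : Prop where
  push : ∀ {B : Type u} [TopologicalSpace B] {θ η : TangentialStructure d B} (g : PushMap θ η),
    IsHomotopyEquiv g.map → IsHomotopyEquiv (F.push g).hom
  pull : ∀ {B' B : Type u} [TopologicalSpace B'] [TopologicalSpace B]
    {θ' : TangentialStructure d B'} {θ : TangentialStructure d B} (p : PullSquare θ' θ),
    IsHomotopyEquiv p.f → IsHomotopyEquiv (F.pull p).hom

/-- Postcomposition of a bivariant theory with a functor. -/
def BivariantTheory.postcomp {d : ℕ} {A : Type*} [Category A] {A' : Type*} [Category A']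
    (F : BivariantTheory.{u} d A) (G : A ⥤ A') : BivariantTheory.{u} d A' where
  obj θ := G.obj (F.obj θ)
  push g := G.map (F.push g)
  pull p := G.map (F.pull p)
  push_id θ := by rw [F.push_id, G.map_id]
  push_comp g h := by rw [F.push_comp, G.map_comp]
  pull_id θ := by rw [F.pull_id, G.map_id]
  pull_comp q p := by rw [F.pull_comp, G.map_comp]
  push_pull p q g g' h₁ h₂ := by
    rw [← G.map_comp, ← G.map_comp, F.push_pull p q g g' h₁ h₂]

/-! ## The simplicial thickening -/

/-- The topological simplex `Δ^n`. -/
abbrev Simp (n : SimplexCategory) : Type := stdSimplex ℝ (Fin (n.len + 1))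

/-- The map of topological simplices induced by a simplicial operator. -/
def Simp.map {m n : SimplexCategory} (φ : m ⟶ n) : C(Simp m, Simp n) :=
  ⟨stdSimplex.map φ, stdSimplex.continuous_map _⟩

theorem Simp.map_id (n : SimplexCategory) : Simp.map (𝟙 n) = ContinuousMap.id _ := by
  ext1 t
  exact stdSimplex.map_id_apply t

theorem Simp.map_comp {l m n : SimplexCategory} (φ : l ⟶ m) (ψ : m ⟶ n) :
    Simp.map (φ ≫ ψ) = (Simp.map ψ).comp (Simp.map φ) := by
  ext1 t
  exact (stdSimplex.map_comp_apply φ ψ t).symm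

section Thickening

variable {d : ℕ} {B B' : Type u} [TopologicalSpace B] [TopologicalSpace B']

/-- `θ × id_{Δ^n} : X × Δ^n → BO(d) × (B × Δ^n)`. -/
def TangentialStructure.prodSimp (θ : TangentialStructure d B) (n : SimplexCategory) :
    TangentialStructure d (B × Simp n) where
  X := θ.X × Simp n
  map := ⟨fun z => ((θ.map z.1).1, (θ.map z.1).2, z.2), by fun_prop⟩
  fibration := by
    intro Y _ H h₀ hH
    obtain ⟨G, hG, hG₀⟩ := θ.fibration Y ⟨fun z => ((H z).1, (H z).2.1), by fun_prop⟩
      ⟨fun y => (h₀ y).1, by fun_prop⟩ (fun y => by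
        have h := hH y
        simp only [ContinuousMap.coe_mk] at h ⊢
        rw [← h])
    refine ⟨⟨fun z => (G z, (H z).2.2), by fun_prop⟩, fun z => ?_, fun y => ?_⟩
    · have h := hG z
      simp only [ContinuousMap.coe_mk] at h ⊢
      rw [h]
    · have h := hH y
      simp only [ContinuousMap.coe_mk] at h ⊢
      rw [← h, hG₀]
      rfl

/-- `g × id_{Δ^n}`. -/
def PushMap.prodSimp {θ η : TangentialStructure d B} (g : PushMap θ η) (n : SimplexCategory) :
    PushMap (θ.prodSimp n) (η.prodSimp n) where
  map := g.map.prodMap (ContinuousMap.id _)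
  comm := fun z => by
    change ((η.map (g.map z.1)).1, (η.map (g.map z.1)).2, z.2) = _
    rw [g.comm]
    rfl

/-- The product of a pull-back square with the map of simplices induced by `φ`. -/
def PullSquare.prodSimp {θ' : TangentialStructure d B'} {θ : TangentialStructure d B}
    (p : PullSquare θ' θ) {m n : SimplexCategory} (φ : m ⟶ n) :
    PullSquare (θ'.prodSimp m) (θ.prodSimp n) where
  f := p.f.prodMap (Simp.map φ)
  F := p.F.prodMap (Simp.map φ)
  isPullback := by
    let x (s : Limits.PullbackCone (TopCat.ofHom (θ.prodSimp n).map)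
        (TopCat.ofHom ((ContinuousMap.id (BO d)).prodMap (p.f.prodMap (Simp.map φ))))) :
        C(s.pt, θ.X) :=
      ⟨fun z => (s.fst.hom z).1, continuous_fst.comp s.fst.hom.continuous⟩
    let y (s : Limits.PullbackCone (TopCat.ofHom (θ.prodSimp n).map)
        (TopCat.ofHom ((ContinuousMap.id (BO d)).prodMap (p.f.prodMap (Simp.map φ))))) :
        C(s.pt, BO d × B') :=
      ⟨fun z => ((s.snd.hom z).1, (s.snd.hom z).2.1),
        (continuous_fst.comp s.snd.hom.continuous).prodMk
          ((continuous_fst.comp continuous_snd).comp s.snd.hom.continuous)⟩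
    have hxy : ∀ s z, θ.map (x s z) = ((y s z).1, p.f (y s z).2) := fun s z => by
      have h := ConcreteCategory.congr_hom s.condition z
      exact Prod.ext (congrArg (fun w : BO d × B × Simp n => w.1) h)
        (congrArg (fun w : BO d × B × Simp n => w.2.1) h)
    refine ⟨⟨TopCat.ext fun z => ?_⟩, ⟨Limits.PullbackCone.IsLimit.mk _
      (fun s => TopCat.ofHom ((p.lift (x s) (y s) (hxy s)).prodMk
          ⟨fun z => (s.snd.hom z).2.2,
            (continuous_snd.comp continuous_snd).comp s.snd.hom.continuous⟩))
      (fun s => TopCat.ext fun z => ?_) (fun s => TopCat.ext fun z => ?_)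
      (fun s k h₁ h₂ => TopCat.ext fun z => ?_)⟩⟩
    · have h := p.comm z.1
      exact Prod.ext (congrArg (fun w : BO d × B => w.1) h)
        (Prod.ext (congrArg (fun w : BO d × B => w.2) h) rfl)
    · have h := ConcreteCategory.congr_hom s.condition z
      exact Prod.ext (p.F_lift (x s) (y s) (hxy s) z)
        (congrArg (fun w : BO d × B × Simp n => w.2.2) h).symm
    · have h := p.map_lift (x s) (y s) (hxy s) z
      exact Prod.ext (congrArg (fun w : BO d × B' => w.1) h)
        (Prod.ext (congrArg (fun w : BO d × B' => w.2) h) rfl)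
    · have e₁ := ConcreteCategory.congr_hom h₁ z
      have e₂ := ConcreteCategory.congr_hom h₂ z
      refine Prod.ext (p.point_ext ?_ ?_) (congrArg (fun w : BO d × B' × Simp m => w.2.2) e₂)
      · exact (congrArg (fun w : θ.X × Simp n => w.1) e₁).trans
          (p.F_lift (x s) (y s) (hxy s) z).symm
      · refine Eq.trans ?_ (p.map_lift (x s) (y s) (hxy s) z).symm
        exact Prod.ext (congrArg (fun w : BO d × B' × Simp m => w.1) e₂)
          (congrArg (fun w : BO d × B' × Simp m => w.2.1) e₂)

end Thickening

/-- The simplicial thickening `F_•` of a bivariant theory `F`, with `F(θ)_n = F(θ × id_{Δ^n})`. -/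
def BivariantTheory.thickening {d : ℕ} {A : Type v} [Category.{w} A]
    (F : BivariantTheory.{u} d A) : BivariantTheory.{u} d (SimplicialObject A) where
  obj θ :=
    { obj := fun n => F.obj (θ.prodSimp n.unop)
      map := fun φ => F.pull ((PullSquare.id θ).prodSimp φ.unop)
      map_id := fun n => by
        rw [← F.pull_id]
        congr 1
        apply PullSquare.ext <;> simp only [PullSquare.prodSimp, unop_id, Simp.map_id] <;> rfl
      map_comp := fun φ ψ => by
        rw [← F.pull_comp]
        congr 1
        apply PullSquare.ext <;>
          simp only [PullSquare.prodSimp, unop_comp, Simp.map_comp] <;> rfl }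
  push g :=
    { app := fun n => F.push (g.prodSimp n.unop)
      naturality := fun m n φ =>
        (F.push_pull _ _ (g.prodSimp m.unop) (g.prodSimp n.unop) rfl rfl).symm }
  pull p :=
    { app := fun n => F.pull (p.prodSimp (𝟙 n.unop))
      naturality := fun m n φ => by
        dsimp only
        rw [← F.pull_comp, ← F.pull_comp]
        congr 1
        apply PullSquare.ext <;>
          simp only [PullSquare.prodSimp, PullSquare.comp, Simp.map_id] <;> rfl }
  push_id θ := by
    ext n
    exact F.push_id (θ.prodSimp n.unop)
  push_comp g h := by
    ext n
    exact F.push_comp (g.prodSimp n.unop) (h.prodSimp n.unop)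
  pull_id θ := by
    ext n
    refine Eq.trans ?_ (F.pull_id (θ.prodSimp n.unop))
    dsimp only
    congr 1
    apply PullSquare.ext <;> simp only [PullSquare.prodSimp, Simp.map_id] <;> rfl
  pull_comp q p := by
    ext n
    refine Eq.trans ?_ (F.pull_comp (q.prodSimp (𝟙 n.unop)) (p.prodSimp (𝟙 n.unop)))
    dsimp only
    congr 1
    apply PullSquare.ext <;>
      simp only [PullSquare.prodSimp, PullSquare.comp, Simp.map_id] <;> rfl
  push_pull p q g g' h₁ h₂ := by
    ext n
    refine F.push_pull _ _ _ _ ?_ ?_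
    · simp only [PullSquare.prodSimp, h₁]
    · exact ContinuousMap.ext fun z => Prod.ext (DFunLike.congr_fun h₂ z.1) rfl

/-! ## Non-unital categories and their classifying spaces -/

/-- A small non-unital category, presented by its sets of objects and of morphisms and by the
graph of its composition: `IsComp f g h` says that `h` is the composite of `f` followed by `g`. -/
structure NonunitalCat : Type (u + 1) where
  Obj : Type u
  Mor : Type u
  src : Mor → Obj
  tgt : Mor → Obj
  IsComp : Mor → Mor → Mor → Prop
  composable : ∀ {f g h}, IsComp f g h → tgt f = src g ∧ src h = src f ∧ tgt h = tgt g
  comp_unique : ∀ {f g h h'}, IsComp f g h → IsComp f g h' → h = h'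
  comp_assoc : ∀ {f g k h m n}, IsComp f g h → IsComp g k m → (IsComp h k n ↔ IsComp f m n)

namespace NonunitalCat

/-- Functors of non-unital categories. -/
@[ext]
structure Hom (C D : NonunitalCat.{u}) where
  obj : C.Obj → D.Obj
  mor : C.Mor → D.Mor
  src : ∀ f, D.src (mor f) = obj (C.src f)
  tgt : ∀ f, D.tgt (mor f) = obj (C.tgt f)
  comp : ∀ f g h, C.IsComp f g h → D.IsComp (mor f) (mor g) (mor h)

instance category : Category.{u} NonunitalCat.{u} where
  Hom := Hom
  id C := ⟨id, id, fun _ => rfl, fun _ => rfl, fun _ _ _ h => h⟩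
  comp F G := ⟨G.obj ∘ F.obj, G.mor ∘ F.mor, fun f => (G.src _).trans (congrArg G.obj (F.src f)),
    fun f => (G.tgt _).trans (congrArg G.obj (F.tgt f)),
    fun _ _ _ h => G.comp _ _ _ (F.comp _ _ _ h)⟩

/-- The `n`-simplices of the nerve: the functors to `C` from the non-unital category
`0 → 1 → ⋯ → n`, that is, `n` composable morphisms together with all their composites. -/
@[ext]
structure NerveSimplex (C : NonunitalCat.{u}) (n : ℕ) where
  vertex : Fin (n + 1) → C.Obj
  edge : ∀ i j : Fin (n + 1), i < j → C.Mor
  src : ∀ i j h, C.src (edge i j h) = vertex i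
  tgt : ∀ i j h, C.tgt (edge i j h) = vertex j
  comp : ∀ i j k hij hjk, C.IsComp (edge i j hij) (edge j k hjk) (edge i k (hij.trans hjk))

/-- The face of a simplex of the nerve that corresponds to a strictly monotone map. -/
def NerveSimplex.face {C : NonunitalCat.{u}} {m n : ℕ} (e : Fin (m + 1) ↪o Fin (n + 1))
    (s : C.NerveSimplex n) : C.NerveSimplex m where
  vertex i := s.vertex (e i)
  edge i j h := s.edge (e i) (e j) (e.strictMono h)
  src _ _ _ := s.src _ _ _
  tgt _ _ _ := s.tgt _ _ _
  comp _ _ _ _ _ := s.comp _ _ _ _ _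

/-- The nerve of a non-unital category, a semi-simplicial set. -/
def nerve : NonunitalCat.{u} ⥤ (SemiSimplexCategoryᵒᵖ ⥤ Type u) where
  obj C :=
    { obj := fun n => C.NerveSimplex n.unop.len
      map := fun φ => ↾(NerveSimplex.face (SemiSimplexCategory.homEquiv φ.unop))
      map_id := fun n => by rw [unop_id, SemiSimplexCategory.homEquiv_id]; rfl
      map_comp := fun φ ψ => by rw [unop_comp, SemiSimplexCategory.homEquiv_comp]; rfl }
  map F :=
    { app := fun n => ↾fun s =>
        { vertex := fun i => F.obj (s.vertex i)
          edge := fun i j h => F.mor (s.edge i j h)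
          src := fun i j h => (F.src _).trans (congrArg F.obj (s.src i j h))
          tgt := fun i j h => (F.tgt _).trans (congrArg F.obj (s.tgt i j h))
          comp := fun _ _ _ _ _ => F.comp _ _ _ (s.comp _ _ _ _ _) }
      naturality := fun _ _ _ => rfl }
  map_id _ := rfl
  map_comp _ _ := rfl

end NonunitalCat

/-- The topological simplex of dimension `n`, for `n` an object of the semi-simplex category. -/
abbrev SSimp (n : SemiSimplexCategory) : Type := Simp (SemiSimplexCategory.toSimplexCategory.obj n)

/-- The identifications `(φ^* x, t) ~ (x, φ_* t)` in the fat geometric realization. -/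
inductive FatRel (X : SemiSimplexCategoryᵒᵖ ⥤ TopCat.{u}) :
    (Σ n : SemiSimplexCategory, X.obj (op n) × SSimp n) →
      (Σ n : SemiSimplexCategory, X.obj (op n) × SSimp n) → Prop
  | face {m n : SemiSimplexCategory} (φ : m ⟶ n) (x : X.obj (op n)) (t : SSimp m) :
      FatRel X ⟨m, X.map φ.op x, t⟩
        ⟨n, x, Simp.map (SemiSimplexCategory.toSimplexCategory.map φ) t⟩

/-- The (fat) geometric realization of a semi-simplicial space. -/
def fatRealization : (SemiSimplexCategoryᵒᵖ ⥤ TopCat.{u}) ⥤ TopCat.{u} where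
  obj X := TopCat.of (Quot (FatRel X))
  map {X Y} f := TopCat.ofHom
    ⟨Quot.map (fun z => ⟨z.1, f.app (op z.1) z.2.1, z.2.2⟩) (by
        rintro _ _ ⟨φ, x, t⟩
        have h := ConcreteCategory.congr_hom (f.naturality φ.op) x
        simp only [TopCat.comp_app] at h
        rw [h]
        exact FatRel.face φ _ t),
      continuous_quot_map _ (by
        refine continuous_sigma fun n => ?_
        refine Continuous.comp (g := Sigma.mk n) continuous_sigmaMk ?_
        exact ((f.app (op n)).hom.continuous.comp continuous_fst).prodMk continuous_snd)⟩
  map_id X := by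
    refine TopCat.ext fun z => ?_
    induction z using Quot.ind
    rfl
  map_comp f g := by
    refine TopCat.ext fun z => ?_
    induction z using Quot.ind
    rfl

/-- The classifying space of a non-unital category: the geometric realization of its nerve. -/
def classifyingSpace : NonunitalCat.{u} ⥤ TopCat.{u} :=
  NonunitalCat.nerve ⋙ (Functor.whiskeringRight _ _ _).obj TopCat.discrete ⋙ fatRealization

/-- The (fat) geometric realization of a simplicial space. -/
def simplicialFatRealization : SimplicialObject TopCat.{u} ⥤ TopCat.{u} :=
  (Functor.whiskeringLeft _ _ _).obj SemiSimplexCategory.toSimplexCategory.op ⋙ fatRealization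

/-- The classifying space of a simplicial non-unital category: the (fat) geometric realization of
the degree-wise classifying spaces. -/
def simplicialClassifyingSpace : SimplicialObject NonunitalCat.{u} ⥤ TopCat.{u} :=
  (SimplicialObject.whiskering _ _).obj classifyingSpace ⋙ simplicialFatRealization

/-! ## Bundles of smooth manifolds embedded fiberwise in `B × ℝ^∞` -/

section Bundles

variable {B : Type u} [TopologicalSpace B]

/-- A family `φ_s : F → ℝ^∞` of maps on a manifold `F` is fiberwise smooth: every coordinate of
every `φ_s` is smooth, and all its partial derivatives in the direction of `F` are continuous in
`(s, x)` jointly (they are computed in charts of `F`). -/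
def FiberwiseSmooth {S : Type u} [TopologicalSpace S] {V H : Type} [NormedAddCommGroup V]
    [NormedSpace ℝ V] [TopologicalSpace H] (I : ModelWithCorners ℝ V H) {F : Type}
    [TopologicalSpace F] [ChartedSpace H F] (φ : S → F → RInf) : Prop :=
  ∀ j : ℕ, (∀ s, ContMDiff I 𝓘(ℝ, ℝ) ∞ (fun x => φ s x j)) ∧
    ∀ (x₀ : F) (k : ℕ), ContinuousOn
      (fun z : S × V => iteratedFDerivWithin ℝ k
        (fun y => φ z.1 ((extChartAt I x₀).symm y) j) (extChartAt I x₀).target z.2)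
      (Set.univ ×ˢ (extChartAt I x₀).target)

/-- The subset `E` of `B × ℝ^∞`, with the projection to `B`, is a fiber bundle of compact smooth
manifolds modelled on `I`, fiberwise smoothly embedded, and the subset of `E` formed by the
boundaries of the fibers is `E ∩ D`. In detail: locally on `B` there are a compact smooth manifold
`F` and a local trivialization `U × F → E|_U`, `(s, x) ↦ (s, φ_s(x))`, which is a homeomorphism and
for which `φ` is a fiberwise smooth family of immersions `F → ℝ^∞`. -/
def IsSmoothBundle {V H : Type} [NormedAddCommGroup V] [NormedSpace ℝ V] [TopologicalSpace H]
    (I : ModelWithCorners ℝ V H) (E D : Set (B × RInf)) : Prop :=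
  ∀ b₀ : B, ∃ U : Set B, IsOpen U ∧ b₀ ∈ U ∧
    ∃ (F : Type) (_ : TopologicalSpace F) (_ : ChartedSpace H F),
      IsManifold I ∞ F ∧ CompactSpace F ∧ T2Space F ∧
      ∃ φ : ↥U → F → RInf,
        IsEmbedding (fun z : U × F => ((z.1 : B), φ z.1 z.2)) ∧
        Set.range (fun z : U × F => ((z.1 : B), φ z.1 z.2)) = {e | e ∈ E ∧ e.1 ∈ U} ∧
        FiberwiseSmooth I φ ∧
        (∀ (s : U) (x : F) (v : TangentSpace I x),
          (∀ j, mfderiv I 𝓘(ℝ, ℝ) (fun y => φ s y j) x v = (0 : ℝ)) → v = 0) ∧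
        ∀ (s : U) (x : F), x ∈ I.boundary F ↔ ((s : B), φ s x) ∈ D

/-- Over each compact subset of `B`, the set `E` is contained in `B × ℝ^N` for some `N`. -/
def CompactlyFinite (E : Set (B × RInf)) : Prop :=
  ∀ K : Set B, IsCompact K → ∃ N : ℕ, ∀ e ∈ E, e.1 ∈ K → ∀ j, N ≤ j → e.2 j = 0

/-- The vertical tangent space `T^v_e E ⊆ ℝ^∞` at `e = (b, v)`: the linear span of the tangent
cone at `v` of the fiber of `E` over `b`. (The tangent cone of a smooth submanifold at an interior
point is the tangent space. With real coefficients it spans the tangent space also at a boundary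
point.) -/
def vertTangent (E : Set (B × RInf)) (e : B × RInf) : Submodule ℝ RInf :=
  Submodule.span ℝ (tangentConeAt ℝ {v | (e.1, v) ∈ E} e.2)

/-- The line in `ℝ^∞` spanned by the time direction. -/
def timeLine : Submodule ℝ RInf := Submodule.span ℝ {Finsupp.single 0 1}

end Bundles

/-! ## The cobordism category of a parametrized tangential structure -/

section Cobordisms

variable {d : ℕ} {B B' B'' : Type u} [TopologicalSpace B] [TopologicalSpace B']
  [TopologicalSpace B'']

/-- An object `(E, p, a, l)` of `C(θ)`: a bundle of closed smooth `(d-1)`-manifolds in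
`B × {a} × ℝ^{d-1+∞}`, with a lift `l` to `X` of the once stabilized vertical Gauß map and of the
projection to `B`. -/
structure CobObj (θ : TangentialStructure d B) where
  a : ℝ
  E : Set (B × RInf)
  time : ∀ e ∈ E, e.2 0 = a
  bundle : IsSmoothBundle (𝓡 (d - 1)) E ∅
  finite : CompactlyFinite E
  l : C(E, θ.X)
  gauss : ∀ e : E, (θ.map (l e)).1.1 = timeLine ⊔ vertTangent E e
  proj : ∀ e : E, (θ.map (l e)).2 = e.1.1

/-- A morphism of `C(θ)` from `src` to `tgt`: a bundle of compact smooth `d`-manifolds in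
`B × [a₀, a₁] × ℝ^{d-1+∞}`, cylindrical near `a₀` and `a₁` with ends `src` and `tgt`, whose
fibers have all their boundary in these ends, with a lift `l` to `X` of the vertical Gauß map and of
the projection to `B`. -/
structure Cob [NeZero d] (θ : TangentialStructure d B) where
  src : CobObj θ
  tgt : CobObj θ
  lt : src.a < tgt.a
  W : Set (B × RInf)
  time : ∀ w ∈ W, w.2 0 ∈ Set.Icc src.a tgt.a
  bundle : IsSmoothBundle (𝓡∂ d) W (src.E ∪ tgt.E)
  finite : CompactlyFinite W
  cyl_src : ∀ b₀ : B, ∃ U ∈ 𝓝 b₀, ∃ ε > (0 : ℝ), ∀ b ∈ U, ∀ v : RInf,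
    v 0 ∈ Set.Ico src.a (src.a + ε) → ((b, v) ∈ W ↔ (b, v.setTime src.a) ∈ src.E)
  cyl_tgt : ∀ b₀ : B, ∃ U ∈ 𝓝 b₀, ∃ ε > (0 : ℝ), ∀ b ∈ U, ∀ v : RInf,
    v 0 ∈ Set.Ioc (tgt.a - ε) tgt.a → ((b, v) ∈ W ↔ (b, v.setTime tgt.a) ∈ tgt.E)
  l : C(W, θ.X)
  gauss : ∀ w : W, (θ.map (l w)).1.1 = vertTangent W w
  proj : ∀ w : W, (θ.map (l w)).2 = w.1.1
  l_src : ∀ e (h : e ∈ src.E) (h' : e ∈ W), l ⟨e, h'⟩ = src.l ⟨e, h⟩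
  l_tgt : ∀ e (h : e ∈ tgt.E) (h' : e ∈ W), l ⟨e, h'⟩ = tgt.l ⟨e, h⟩

theorem CobObj.ext' {θ : TangentialStructure d B} {x y : CobObj θ} (ha : x.a = y.a)
    (hE : x.E = y.E) (hl : ∀ e (h : e ∈ x.E) (h' : e ∈ y.E), x.l ⟨e, h⟩ = y.l ⟨e, h'⟩) :
    x = y := by
  obtain ⟨a, E, _, _, _, l, _, _⟩ := x
  obtain ⟨a', E', _, _, _, l', _, _⟩ := y
  obtain rfl : a = a' := ha
  obtain rfl : E = E' := hE
  obtain rfl : l = l' := ContinuousMap.ext fun e => hl e.1 e.2 e.2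
  rfl

theorem Cob.ext' [NeZero d] {θ : TangentialStructure d B} {f g : Cob θ} (hs : f.src = g.src)
    (ht : f.tgt = g.tgt) (hW : f.W = g.W)
    (hl : ∀ w (h : w ∈ f.W) (h' : w ∈ g.W), f.l ⟨w, h⟩ = g.l ⟨w, h'⟩) : f = g := by
  obtain ⟨s, t, _, W, _, _, _, _, _, l, _, _, _, _⟩ := f
  obtain ⟨s', t', _, W', _, _, _, _, _, l', _, _, _, _⟩ := g
  obtain rfl : s = s' := hs
  obtain rfl : t = t' := ht
  obtain rfl : W = W' := hW
  obtain rfl : l = l' := ContinuousMap.ext fun e => hl e.1 e.2 e.2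
  rfl

/-- `h` is the composite of `f` and `g`: the union of subsets of `B × ℝ^{d+∞}`, with the union of
the two tangential structures. (As `f` and `g` are cylindrical near their common end, the union of
composable `f` and `g` is again a bundle of the required kind.) -/
structure Cob.IsComp [NeZero d] {θ : TangentialStructure d B} (f g h : Cob θ) : Prop where
  mid : f.tgt = g.src
  src : h.src = f.src
  tgt : h.tgt = g.tgt
  W : h.W = f.W ∪ g.W
  left : ∀ w (hf : w ∈ f.W) (hh : w ∈ h.W), h.l ⟨w, hh⟩ = f.l ⟨w, hf⟩
  right : ∀ w (hg : w ∈ g.W) (hh : w ∈ h.W), h.l ⟨w, hh⟩ = g.l ⟨w, hg⟩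

/-- The non-unital category `C(θ)` of parametrized `θ`-cobordisms. -/
def cobCat [NeZero d] (θ : TangentialStructure d B) : NonunitalCat.{u} where
  Obj := CobObj θ
  Mor := Cob θ
  src := Cob.src
  tgt := Cob.tgt
  IsComp := Cob.IsComp
  composable h := ⟨h.mid, h.src, h.tgt⟩
  comp_unique {f g h h'} c c' := by
    refine Cob.ext' (c.src.trans c'.src.symm) (c.tgt.trans c'.tgt.symm) (c.W.trans c'.W.symm) ?_
    intro w hw hw'
    have hw₂ := hw
    rw [c.W] at hw₂
    rcases hw₂ with hw₂ | hw₂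
    · rw [c.left w hw₂, c'.left w hw₂]
    · rw [c.right w hw₂, c'.right w hw₂]
  comp_assoc {f g k h m n} c c' := by
    constructor
    · intro e
      refine ⟨c.mid.trans c'.src.symm, e.src.trans c.src, e.tgt.trans c'.tgt.symm, ?_, ?_, ?_⟩
      · rw [e.W, c.W, c'.W, Set.union_assoc]
      · intro w hf hn
        have hh : w ∈ h.W := by rw [c.W]; exact Or.inl hf
        rw [e.left w hh, c.left w hf]
      · intro w hm hn
        have hm₂ := hm
        rw [c'.W] at hm₂
        rcases hm₂ with hm₂ | hm₂
        · have hh : w ∈ h.W := by rw [c.W]; exact Or.inr hm₂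
          rw [e.left w hh, c.right w hm₂, c'.left w hm₂]
        · rw [e.right w hm₂, c'.right w hm₂]
    · intro e
      refine ⟨c.tgt.trans c'.mid, e.src.trans c.src.symm, e.tgt.trans c'.tgt, ?_, ?_, ?_⟩
      · rw [e.W, c.W, c'.W, Set.union_assoc]
      · intro w hh hn
        have hh₂ := hh
        rw [c.W] at hh₂
        rcases hh₂ with hh₂ | hh₂
        · rw [e.left w hh₂, c.left w hh₂]
        · have hm : w ∈ m.W := by rw [c'.W]; exact Or.inl hh₂
          rw [e.right w hm, c.right w hh₂, c'.left w hh₂]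
      · intro w hk hn
        have hm : w ∈ m.W := by rw [c'.W]; exact Or.inr hk
        rw [e.right w hm, c'.right w hk]

/-! ### Push-forward -/

/-- Post-composition of the tangential structure of an object with `g`. -/
def CobObj.push {θ η : TangentialStructure d B} (g : PushMap θ η) (x : CobObj θ) : CobObj η where
  a := x.a
  E := x.E
  time := x.time
  bundle := x.bundle
  finite := x.finite
  l := g.map.comp x.l
  gauss e := by rw [ContinuousMap.comp_apply, g.comm, x.gauss]
  proj e := by rw [ContinuousMap.comp_apply, g.comm, x.proj]

/-- Post-composition of the tangential structure of a morphism with `g`. -/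
def Cob.push [NeZero d] {θ η : TangentialStructure d B} (g : PushMap θ η) (f : Cob θ) :
    Cob η where
  src := f.src.push g
  tgt := f.tgt.push g
  lt := f.lt
  W := f.W
  time := f.time
  bundle := f.bundle
  finite := f.finite
  cyl_src := f.cyl_src
  cyl_tgt := f.cyl_tgt
  l := g.map.comp f.l
  gauss e := by rw [ContinuousMap.comp_apply, g.comm, f.gauss]
  proj e := by rw [ContinuousMap.comp_apply, g.comm, f.proj]
  l_src e h h' := congrArg g.map (f.l_src e h h')
  l_tgt e h h' := congrArg g.map (f.l_tgt e h h')

/-- The push-forward functor `g_* : C(θ) → C(η)`. -/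
def cobPush [NeZero d] {θ η : TangentialStructure d B} (g : PushMap θ η) :
    cobCat θ ⟶ cobCat η :=
  NonunitalCat.Hom.mk (C := cobCat θ) (D := cobCat η) (CobObj.push g) (Cob.push g)
    (fun _ => rfl) (fun _ => rfl) (fun _ _ _ c =>
      ⟨congrArg (CobObj.push g) c.mid, congrArg (CobObj.push g) c.src,
        congrArg (CobObj.push g) c.tgt, c.W,
        fun w hf hh => congrArg g.map (c.left w hf hh),
        fun w hf hh => congrArg g.map (c.right w hf hh)⟩)

/-! ### Pull-back -/

/-- The pull-back of a subset `E` of `B × ℝ^∞` along `f : B' → B`. -/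
def pullSet (f : C(B', B)) (E : Set (B × RInf)) : Set (B' × RInf) := {e | (f e.1, e.2) ∈ E}

/-- The canonical map from the pull-back of `E` to `E`. -/
def pullSetMap (f : C(B', B)) (E : Set (B × RInf)) : C(pullSet f E, E) :=
  ⟨fun e => ⟨(f e.1.1, e.1.2), e.2⟩, by fun_prop⟩

theorem CompactlyFinite.pull (f : C(B', B)) {E : Set (B × RInf)} (h : CompactlyFinite E) :
    CompactlyFinite (pullSet f E) := by
  intro K hK
  obtain ⟨N, hN⟩ := h (f '' K) (hK.image f.continuous)
  exact ⟨N, fun e he heK => hN (f e.1, e.2) he (Set.mem_image_of_mem f heK)⟩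

theorem IsSmoothBundle.pull (f : C(B', B)) {V H : Type} [NormedAddCommGroup V] [NormedSpace ℝ V]
    [TopologicalSpace H] {I : ModelWithCorners ℝ V H} {E D : Set (B × RInf)}
    (h : IsSmoothBundle I E D) : IsSmoothBundle I (pullSet f E) (pullSet f D) := by
  intro b₀
  obtain ⟨U, hU, hb, F, _, _, hM, hC, hT, φ, hemb, hrange, hsm, himm, hbd⟩ := h (f b₀)
  let r : C(f ⁻¹' U, U) := ⟨fun s => ⟨f s.1, s.2⟩, by fun_prop⟩
  refine ⟨f ⁻¹' U, hU.preimage f.continuous, hb, F, _, _, hM, hC, hT, fun s => φ (r s), ?_, ?_,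
    ?_, fun s => himm (r s), fun s => hbd (r s)⟩
  · have hk : Continuous (fun z : (f ⁻¹' U) × F => ((z.1 : B'), φ (r z.1) z.2)) := by
      have h₁ : Continuous (fun z : (f ⁻¹' U) × F => (r z.1, z.2)) := by fun_prop
      exact (continuous_subtype_val.comp continuous_fst).prodMk
        (continuous_snd.comp (hemb.continuous.comp h₁))
    have hq : IsEmbedding (fun z : (f ⁻¹' U) × F => ((z.1 : B'), (r z.1, z.2))) := by
      refine IsEmbedding.of_comp (g := fun z : B' × (U × F) => (z.1, z.2.2)) (by fun_prop)
        (by fun_prop) ?_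
      exact IsEmbedding.subtypeVal.prodMap IsEmbedding.id
    have hc := (IsEmbedding.id (X := B')).prodMap hemb |>.comp hq
    exact IsEmbedding.of_comp (g := fun z : B' × RInf => (z.1, (f z.1, z.2))) hk (by fun_prop) hc
  · ext e
    constructor
    · rintro ⟨⟨s, x⟩, rfl⟩
      have : ((r s : B), φ (r s) x) ∈ {e | e ∈ E ∧ e.1 ∈ U} := by
        rw [← hrange]
        exact ⟨(r s, x), rfl⟩
      exact this
    · rintro ⟨he, heU⟩
      have : (f e.1, e.2) ∈ {e | e ∈ E ∧ e.1 ∈ U} := ⟨he, heU⟩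
      rw [← hrange] at this
      obtain ⟨⟨s, x⟩, hsx⟩ := this
      have h₁ : s = r ⟨e.1, heU⟩ := Subtype.ext (congrArg Prod.fst hsx)
      have h₂ : φ s x = e.2 := congrArg Prod.snd hsx
      exact ⟨(⟨e.1, heU⟩, x), Prod.ext rfl (by rw [← h₂, h₁])⟩
  · intro j
    refine ⟨fun s => (hsm j).1 (r s), fun x₀ k => ?_⟩
    refine ContinuousOn.comp (g := fun z : U × V => iteratedFDerivWithin ℝ k
        (fun y => φ z.1 ((extChartAt I x₀).symm y) j) (extChartAt I x₀).target z.2)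
      (f := fun z : (f ⁻¹' U) × V => (r z.1, z.2)) ((hsm j).2 x₀ k) ?_ ?_
    · exact Continuous.continuousOn (by fun_prop)
    · exact fun z hz => ⟨Set.mem_univ _, hz.2⟩

section Pull

variable {θ : TangentialStructure d B} {θ' : TangentialStructure d B'}

/-- The map to `X'` on the pull-back of `E` that is induced by `l : E → X` and the projection
to `B'`. -/
def pullLift (p : PullSquare θ' θ) {E : Set (B × RInf)} (l : C(E, θ.X))
    (h : ∀ e, (θ.map (l e)).2 = e.1.1) : C(pullSet p.f E, θ'.X) :=
  p.lift (l.comp (pullSetMap p.f E))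
    ⟨fun e => ((θ.map (l (pullSetMap p.f E e))).1, e.1.1), by fun_prop⟩
    (fun e => Prod.ext rfl (h (pullSetMap p.f E e)))

theorem F_pullLift (p : PullSquare θ' θ) {E : Set (B × RInf)} (l : C(E, θ.X))
    (h : ∀ e, (θ.map (l e)).2 = e.1.1) (e : pullSet p.f E) :
    p.F (pullLift p l h e) = l (pullSetMap p.f E e) :=
  p.F_lift _ _ _ e

theorem map_pullLift (p : PullSquare θ' θ) {E : Set (B × RInf)} (l : C(E, θ.X))
    (h : ∀ e, (θ.map (l e)).2 = e.1.1) (e : pullSet p.f E) :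
    θ'.map (pullLift p l h e) = ((θ.map (l (pullSetMap p.f E e))).1, e.1.1) :=
  p.map_lift _ _ _ e

/-- The pull-back of an object. -/
def CobObj.pull (p : PullSquare θ' θ) (x : CobObj θ) : CobObj θ' where
  a := x.a
  E := pullSet p.f x.E
  time e he := x.time _ he
  bundle := x.bundle.pull p.f
  finite := x.finite.pull p.f
  l := pullLift p x.l x.proj
  gauss e := by
    rw [map_pullLift, x.gauss]
    rfl
  proj e := by rw [map_pullLift]

/-- The pull-back of a morphism. -/
def Cob.pull [NeZero d] (p : PullSquare θ' θ) (f : Cob θ) : Cob θ' where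
  src := f.src.pull p
  tgt := f.tgt.pull p
  lt := f.lt
  W := pullSet p.f f.W
  time w hw := f.time _ hw
  bundle := f.bundle.pull p.f
  finite := f.finite.pull p.f
  cyl_src b₀ := by
    obtain ⟨U, hU, ε, hε, h⟩ := f.cyl_src (p.f b₀)
    exact ⟨p.f ⁻¹' U, p.f.continuous.continuousAt hU, ε, hε, fun b hb v hv => h (p.f b) hb v hv⟩
  cyl_tgt b₀ := by
    obtain ⟨U, hU, ε, hε, h⟩ := f.cyl_tgt (p.f b₀)
    exact ⟨p.f ⁻¹' U, p.f.continuous.continuousAt hU, ε, hε, fun b hb v hv => h (p.f b) hb v hv⟩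
  l := pullLift p f.l f.proj
  gauss e := by
    rw [map_pullLift, f.gauss]
    rfl
  proj e := by rw [map_pullLift]
  l_src e h h' := by
    have hl : f.l (pullSetMap p.f f.W ⟨e, h'⟩) = f.src.l (pullSetMap p.f f.src.E ⟨e, h⟩) :=
      f.l_src _ h h'
    apply p.point_ext
    · exact (F_pullLift _ _ _ _).trans (hl.trans (F_pullLift p f.src.l f.src.proj ⟨e, h⟩).symm)
    · refine (map_pullLift _ _ _ _).trans (Eq.trans ?_
        (map_pullLift p f.src.l f.src.proj ⟨e, h⟩).symm)
      rw [hl]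
  l_tgt e h h' := by
    have hl : f.l (pullSetMap p.f f.W ⟨e, h'⟩) = f.tgt.l (pullSetMap p.f f.tgt.E ⟨e, h⟩) :=
      f.l_tgt _ h h'
    apply p.point_ext
    · exact (F_pullLift _ _ _ _).trans (hl.trans (F_pullLift p f.tgt.l f.tgt.proj ⟨e, h⟩).symm)
    · refine (map_pullLift _ _ _ _).trans (Eq.trans ?_
        (map_pullLift p f.tgt.l f.tgt.proj ⟨e, h⟩).symm)
      rw [hl]

theorem pullLift_congr (p : PullSquare θ' θ) {E E' : Set (B × RInf)} (l : C(E, θ.X))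
    (h : ∀ e, (θ.map (l e)).2 = e.1.1) (l' : C(E', θ.X)) (h' : ∀ e, (θ.map (l' e)).2 = e.1.1)
    (hl : ∀ w (hw : w ∈ E) (hw' : w ∈ E'), l ⟨w, hw⟩ = l' ⟨w, hw'⟩)
    (e : B' × RInf) (he : e ∈ pullSet p.f E) (he' : e ∈ pullSet p.f E') :
    pullLift p l h ⟨e, he⟩ = pullLift p l' h' ⟨e, he'⟩ := by
  have hl : l (pullSetMap p.f E ⟨e, he⟩) = l' (pullSetMap p.f E' ⟨e, he'⟩) := hl _ _ _
  apply p.point_ext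
  · rw [F_pullLift, F_pullLift, hl]
  · rw [map_pullLift, map_pullLift, hl]

/-- The pull-back functor `f^* : C(θ) → C(θ')`. -/
def cobPull [NeZero d] (p : PullSquare θ' θ) : cobCat θ ⟶ cobCat θ' :=
  NonunitalCat.Hom.mk (C := cobCat θ) (D := cobCat θ') (CobObj.pull p) (Cob.pull p)
    (fun _ => rfl) (fun _ => rfl) (fun f g h c =>
      ⟨congrArg (CobObj.pull p) c.mid, congrArg (CobObj.pull p) c.src,
        congrArg (CobObj.pull p) c.tgt, congrArg (pullSet p.f) c.W,
        fun w hf hh => pullLift_congr p h.l h.proj f.l f.proj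
          (fun w hw hw' => c.left w hw' hw) w hh hf,
        fun w hf hh => pullLift_congr p h.l h.proj g.l g.proj
          (fun w hw hw' => c.right w hw' hw) w hh hf⟩)

end Pull

end Cobordisms

/-! ## The bivariant theories `C`, `C_•` and `BC_•` -/

theorem pullLift_id {d : ℕ} {B : Type u} [TopologicalSpace B] {θ : TangentialStructure d B}
    {E : Set (B × RInf)} (l : C(E, θ.X)) (h : ∀ e, (θ.map (l e)).2 = e.1.1) (e : E) :
    pullLift (PullSquare.id θ) l h e = l e :=
  F_pullLift (PullSquare.id θ) l h e

theorem pullLift_comp {d : ℕ} {B'' B' B : Type u} [TopologicalSpace B''] [TopologicalSpace B']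
    [TopologicalSpace B] {θ'' : TangentialStructure d B''} {θ' : TangentialStructure d B'}
    {θ : TangentialStructure d B} (q : PullSquare θ'' θ') (p : PullSquare θ' θ)
    {E : Set (B × RInf)} (l : C(E, θ.X)) (h : ∀ e, (θ.map (l e)).2 = e.1.1)
    (h' : ∀ e, (θ'.map (pullLift p l h e)).2 = e.1.1) (e : pullSet (q.comp p).f E) :
    pullLift (q.comp p) l h e = pullLift q (pullLift p l h) h' e := by
  apply (q.comp p).point_ext
  · rw [F_pullLift]
    exact ((congrArg p.F (F_pullLift q (pullLift p l h) h' e)).trans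
      (F_pullLift p l h (pullSetMap q.f (pullSet p.f E) e))).symm
  · rw [map_pullLift]
    refine Eq.trans ?_ (map_pullLift q _ _ _).symm
    rw [map_pullLift]
    rfl

theorem pullLift_push {d : ℕ} {B' B : Type u} [TopologicalSpace B'] [TopologicalSpace B]
    {θ' η' : TangentialStructure d B'} {θ η : TangentialStructure d B}
    (p : PullSquare θ' θ) (q : PullSquare η' η) (g : PushMap θ η) (g' : PushMap θ' η')
    (hF : q.F.comp g'.map = g.map.comp p.F)
    {E : Set (B × RInf)} (l : C(E, θ.X)) (h : ∀ e, (θ.map (l e)).2 = e.1.1)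
    (h' : ∀ e, (η.map (g.map.comp l e)).2 = e.1.1) (e : B' × RInf) (he : e ∈ pullSet q.f E)
    (he' : e ∈ pullSet p.f E) (hf : p.f = q.f) :
    pullLift q (g.map.comp l) h' ⟨e, he⟩ = g'.map (pullLift p l h ⟨e, he'⟩) := by
  have hpt : pullSetMap q.f E ⟨e, he⟩ = pullSetMap p.f E ⟨e, he'⟩ :=
    Subtype.ext (Prod.ext (by change q.f e.1 = p.f e.1; rw [hf]) rfl)
  apply q.point_ext
  · rw [F_pullLift]
    refine Eq.trans ?_ (DFunLike.congr_fun hF _).symm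
    rw [ContinuousMap.comp_apply, ContinuousMap.comp_apply, F_pullLift, hpt]
  · rw [map_pullLift, g'.comm, map_pullLift, ContinuousMap.comp_apply, g.comm, hpt]

/-- The bivariant theory `C : θ ↦ C(θ)`. -/
def cobordismTheory (d : ℕ) [NeZero d] : BivariantTheory.{u} d NonunitalCat.{u} where
  obj θ := cobCat θ
  push g := cobPush g
  pull p := cobPull p
  push_id _ := rfl
  push_comp _ _ := rfl
  pull_id θ := NonunitalCat.Hom.ext
    (funext fun x => CobObj.ext' rfl rfl fun e h h' => pullLift_id x.l x.proj ⟨e, h⟩)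
    (funext fun f => Cob.ext'
      (CobObj.ext' rfl rfl fun e h h' => pullLift_id f.src.l f.src.proj ⟨e, h⟩)
      (CobObj.ext' rfl rfl fun e h h' => pullLift_id f.tgt.l f.tgt.proj ⟨e, h⟩) rfl
      fun e h h' => pullLift_id f.l f.proj ⟨e, h⟩)
  pull_comp q p := by
    have hobj : ∀ x, CobObj.pull (q.comp p) x = CobObj.pull q (CobObj.pull p x) := fun x =>
      CobObj.ext' rfl rfl fun e h h' => pullLift_comp q p x.l x.proj (x.pull p).proj ⟨e, h⟩
    exact NonunitalCat.Hom.ext (funext hobj)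
      (funext fun f => Cob.ext' (hobj f.src) (hobj f.tgt) rfl fun e h h' =>
        pullLift_comp q p f.l f.proj (f.pull p).proj ⟨e, h⟩)
  push_pull p q g g' hf hF := by
    have hobj : ∀ x, CobObj.pull q (CobObj.push g x) = CobObj.push g' (CobObj.pull p x) :=
      fun x => CobObj.ext' rfl (congrArg (fun k => pullSet k x.E) hf.symm) fun e h h' =>
        pullLift_push p q g g' hF x.l x.proj (x.push g).proj e h h' hf
    exact NonunitalCat.Hom.ext (funext hobj)
      (funext fun f => Cob.ext' (hobj f.src) (hobj f.tgt)
        (congrArg (fun k => pullSet k f.W) hf.symm) fun e h h' =>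
        pullLift_push p q g g' hF f.l f.proj (f.push g).proj e h h' hf)

/-- The bivariant theory `BC_• : θ ↦ BC(θ)_•`, the classifying space of the parametrized
`θ`-cobordism category `C(θ)_•`, the simplicial thickening of `C`. -/
def cobordismSpaceTheory (d : ℕ) [NeZero d] : BivariantTheory.{u} d TopCat.{u} :=
  (cobordismTheory.{u} d).thickening.postcomp simplicialClassifyingSpace

end ParamCob

end

noncomputable section

namespace ParamCob

/-! ## Homotopy equivalences -/

section HomotopyEquiv

variable {X Y Z W : Type*} [TopologicalSpace X] [TopologicalSpace Y] [TopologicalSpace Z]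
  [TopologicalSpace W]

/-! No geometry of manifolds enters. For every bivariant theory `F` with values in spaces, the fat
realization of `F(θ × Δ^•)` is homotopy invariant, and the theorem is the case in which `F` sends
`θ` to the classifying space of `C(θ)`. The reason is that `F` can be pulled back along every
continuous map of base spaces, not only along simplicial operators, so homotopies between geometric
data can be spread out over simplices.

Two homotopies carry everything: fiberwise homotopic maps induce homotopic push-forwards
(`realization_push_homotopic`), and the contraction of `[0, 1]` to `0` acts on the theory of `θ ×
[0, 1]` as the identity up to homotopy (`realization_contract_homotopic`). As a fat realization has
no degeneracies, the prism `Δ^n × [0, 1]` is replaced by the join `Δ^n * Δ^n = Δ^{2n+1}`, which is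
natural in injective maps. It maps to `Δ^n` by `fold` and to `[0, 1]` by `height`. Pulling an
`n`-simplex back along `fold` and applying the homotopy at time `height` gives a `(2n+1)`-simplex
that joins the two values at the ends of the homotopy; sliding through it is the required homotopy
(`fatRealization_map_homotopic`).

The rest uses fibrations. For (a), by Dold's argument a fiberwise map that is an equivalence of
total spaces has a fiberwise right homotopy inverse of the same kind (`exists_right_inverse`); using
this twice makes the push-forward invertible. For (b), restriction to `B × {0}` is an equivalence
for products by the contraction, and for every structure over `B × [0, 1]` by comparison with a
product through (a). Hence pull-backs along homotopic maps are equivalences simultaneously, and two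
out of six concludes. -/

theorem isHomotopyEquiv_iff {f : C(X, Y)} : IsHomotopyEquiv f ↔
    ∃ g : C(Y, X), (g.comp f).Homotopic (.id X) ∧ (f.comp g).Homotopic (.id Y) := by
  constructor
  · rintro ⟨e, rfl⟩
    exact ⟨e.invFun, e.left_inv, e.right_inv⟩
  · rintro ⟨g, h₁, h₂⟩
    exact ⟨⟨f, g, h₁, h₂⟩, rfl⟩

theorem isHomotopyEquiv_of_homotopic {f f' : C(X, Y)} (h : f.Homotopic f')
    (hf : IsHomotopyEquiv f) : IsHomotopyEquiv f' := by
  obtain ⟨g, h₁, h₂⟩ := isHomotopyEquiv_iff.1 hf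
  exact isHomotopyEquiv_iff.2 ⟨g, ((ContinuousMap.Homotopic.refl g).comp h.symm).trans h₁,
    (h.symm.comp (ContinuousMap.Homotopic.refl g)).trans h₂⟩

/-- A map with a left and a right homotopy inverse is a homotopy equivalence. -/
theorem isHomotopyEquiv_of_inverses {f : C(X, Y)} {g g' : C(Y, X)}
    (h : (g.comp f).Homotopic (.id X)) (h' : (f.comp g').Homotopic (.id Y)) :
    IsHomotopyEquiv f := by
  refine isHomotopyEquiv_iff.2 ⟨g, h, ?_⟩
  have e₁ : (g.comp (f.comp g')).Homotopic g := (ContinuousMap.Homotopic.refl g).comp h'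
  have e₂ : ((g.comp f).comp g').Homotopic g' := h.comp (ContinuousMap.Homotopic.refl g')
  have e₃ : g.Homotopic g' := e₁.symm.trans e₂
  exact ((ContinuousMap.Homotopic.refl f).comp e₃).trans h'

theorem isHomotopyEquiv_of_comp_right {f : C(X, Y)} {g : C(Y, Z)} (hf : IsHomotopyEquiv f)
    (hgf : IsHomotopyEquiv (g.comp f)) : IsHomotopyEquiv g := by
  obtain ⟨k, h₁, h₂⟩ := isHomotopyEquiv_iff.1 hf
  obtain ⟨l, h₃, h₄⟩ := isHomotopyEquiv_iff.1 hgf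
  refine isHomotopyEquiv_of_inverses (g := f.comp l) (g' := f.comp l) ?_ h₄
  have e₁ : ((f.comp l).comp (g.comp (f.comp k))).Homotopic ((f.comp l).comp g) :=
    (ContinuousMap.Homotopic.refl _).comp ((ContinuousMap.Homotopic.refl g).comp h₂)
  have e₂ : (f.comp ((l.comp (g.comp f)).comp k)).Homotopic (f.comp k) :=
    (ContinuousMap.Homotopic.refl f).comp (h₃.comp (ContinuousMap.Homotopic.refl k))
  exact e₁.symm.trans (e₂.trans h₂)

theorem isHomotopyEquiv_of_comp_left {f : C(X, Y)} {g : C(Y, Z)} (hg : IsHomotopyEquiv g)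
    (hgf : IsHomotopyEquiv (g.comp f)) : IsHomotopyEquiv f := by
  obtain ⟨k, h₁, h₂⟩ := isHomotopyEquiv_iff.1 hg
  obtain ⟨l, h₃, h₄⟩ := isHomotopyEquiv_iff.1 hgf
  refine isHomotopyEquiv_of_inverses (g := l.comp g) (g' := l.comp g) h₃ ?_
  have e₁ : ((k.comp g).comp ((f.comp l).comp g)).Homotopic ((f.comp l).comp g) :=
    h₁.comp (ContinuousMap.Homotopic.refl _)
  have e₂ : (k.comp (((g.comp f).comp l).comp g)).Homotopic (k.comp g) :=
    (ContinuousMap.Homotopic.refl k).comp (h₄.comp (ContinuousMap.Homotopic.refl g))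
  exact e₁.symm.trans (e₂.trans h₁)

theorem isHomotopyEquiv_comp {f : C(X, Y)} {g : C(Y, Z)} (hf : IsHomotopyEquiv f)
    (hg : IsHomotopyEquiv g) : IsHomotopyEquiv (g.comp f) := by
  obtain ⟨k, h₁, h₂⟩ := isHomotopyEquiv_iff.1 hf
  obtain ⟨l, h₃, h₄⟩ := isHomotopyEquiv_iff.1 hg
  refine isHomotopyEquiv_iff.2 ⟨k.comp l, ?_, ?_⟩
  · have e : (k.comp ((l.comp g).comp f)).Homotopic (k.comp f) :=
      (ContinuousMap.Homotopic.refl k).comp (h₃.comp (ContinuousMap.Homotopic.refl f))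
    exact e.trans h₁
  · have e : (g.comp ((f.comp k).comp l)).Homotopic (g.comp l) :=
      (ContinuousMap.Homotopic.refl g).comp (h₂.comp (ContinuousMap.Homotopic.refl l))
    exact e.trans h₄

theorem isHomotopyEquiv_id : IsHomotopyEquiv (ContinuousMap.id X) :=
  ⟨ContinuousMap.HomotopyEquiv.refl X, rfl⟩

/-- If `g ∘ f` and `h ∘ g` are homotopy equivalences, then so is `f`. -/
theorem isHomotopyEquiv_of_two_out_of_six {f : C(X, Y)} {g : C(Y, Z)} {h : C(Z, W)}
    (hgf : IsHomotopyEquiv (g.comp f)) (hhg : IsHomotopyEquiv (h.comp g)) :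
    IsHomotopyEquiv f := by
  obtain ⟨k, -, h₁⟩ := isHomotopyEquiv_iff.1 hgf
  obtain ⟨l, h₂, -⟩ := isHomotopyEquiv_iff.1 hhg
  -- The middle map `g` has the left homotopy inverse `l.comp h` and the right one `f.comp k`, so it
  -- is an equivalence, and two out of three applies to `g.comp f`.
  exact isHomotopyEquiv_of_comp_left
    (isHomotopyEquiv_of_inverses (f := g) (g := l.comp h) (g' := f.comp k) h₂ h₁) hgf

end HomotopyEquiv

/-! ## The doubled simplex -/

section Double

/-- The simplex `[n] * [n]`, the join of two copies of `[n]`. -/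
def double (n : SemiSimplexCategory) : SemiSimplexCategory := ⟨n.len + 1 + n.len⟩

/-- The vertices of `[n] * [n]`. -/
def doubleIdx (n : SemiSimplexCategory) : Fin (n.len + 1) ⊕ Fin (n.len + 1) ≃
    Fin ((double n).len + 1) :=
  -- The dimension `n.len + 1 + n.len` is chosen so that the number of vertices is `(n.len + 1) +
  -- (n.len + 1)` by definition.
  finSumFinEquiv (m := n.len + 1) (n := n.len + 1)

/-- The inclusion of the first copy of `[n]` into `[n] * [n]`. -/
def doubleInl (n : SemiSimplexCategory) : n ⟶ double n :=
  SemiSimplexCategory.homEquiv.symm (Fin.castAddOrderEmb (n := n.len + 1) (n.len + 1))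

/-- The inclusion of the second copy of `[n]` into `[n] * [n]`. -/
def doubleInr (n : SemiSimplexCategory) : n ⟶ double n :=
  SemiSimplexCategory.homEquiv.symm (Fin.natAddOrderEmb (m := n.len + 1) (n.len + 1))

/-- The order embedding `e * e`. -/
def doubleEmb {m n : ℕ} (e : Fin m ↪o Fin n) : Fin (m + m) ↪o Fin (n + n) :=
  OrderEmbedding.ofStrictMono (fun i => finSumFinEquiv (Sum.map e e (finSumFinEquiv.symm i))) (by
    intro i j h
    obtain ⟨i, rfl⟩ := finSumFinEquiv.surjective i
    obtain ⟨j, rfl⟩ := finSumFinEquiv.surjective j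
    have he : ∀ i j : Fin m, (i : ℕ) < j → (e i : ℕ) < e j := fun i j h => e.strictMono h
    simp only [Equiv.symm_apply_apply]
    rw [Fin.lt_def] at h ⊢
    rcases i with i | i <;> rcases j with j | j <;>
      simp only [finSumFinEquiv_apply_left, finSumFinEquiv_apply_right, Sum.map_inl, Sum.map_inr,
        Fin.val_castAdd, Fin.val_natAdd] at h ⊢
    · exact he _ _ h
    · omega
    · omega
    · exact Nat.add_lt_add_left (he _ _ (by omega)) _)

/-- The morphism `ψ * ψ : [m] * [m] → [n] * [n]`. -/
def doubleMap {m n : SemiSimplexCategory} (ψ : m ⟶ n) : double m ⟶ double n :=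
  SemiSimplexCategory.homEquiv.symm (doubleEmb (SemiSimplexCategory.homEquiv ψ))

/-- The map of topological simplices induced by a morphism of the semi-simplex category. -/
abbrev SSimp.map {m n : SemiSimplexCategory} (ψ : m ⟶ n) : C(SSimp m, SSimp n) :=
  Simp.map (SemiSimplexCategory.toSimplexCategory.map ψ)

theorem homEquiv_doubleInl (n : SemiSimplexCategory) :
    ⇑(SemiSimplexCategory.homEquiv (doubleInl n)) = doubleIdx n ∘ Sum.inl := rfl

theorem homEquiv_doubleInr (n : SemiSimplexCategory) :
    ⇑(SemiSimplexCategory.homEquiv (doubleInr n)) = doubleIdx n ∘ Sum.inr := rfl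

theorem homEquiv_doubleMap {m n : SemiSimplexCategory} (ψ : m ⟶ n) :
    ⇑(SemiSimplexCategory.homEquiv (doubleMap ψ)) =
      doubleIdx n ∘ Sum.map (SemiSimplexCategory.homEquiv ψ) (SemiSimplexCategory.homEquiv ψ) ∘
        (doubleIdx m).symm := rfl

theorem doubleInl_comp_doubleMap {m n : SemiSimplexCategory} (ψ : m ⟶ n) :
    doubleInl m ≫ doubleMap ψ = ψ ≫ doubleInl n := by
  apply SemiSimplexCategory.hom_ext
  apply DFunLike.coe_injective
  rw [SemiSimplexCategory.homEquiv_comp, SemiSimplexCategory.homEquiv_comp, RelEmbedding.coe_trans,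
    RelEmbedding.coe_trans, homEquiv_doubleInl, homEquiv_doubleInl, homEquiv_doubleMap]
  funext i
  simp

theorem doubleInr_comp_doubleMap {m n : SemiSimplexCategory} (ψ : m ⟶ n) :
    doubleInr m ≫ doubleMap ψ = ψ ≫ doubleInr n := by
  apply SemiSimplexCategory.hom_ext
  apply DFunLike.coe_injective
  rw [SemiSimplexCategory.homEquiv_comp, SemiSimplexCategory.homEquiv_comp, RelEmbedding.coe_trans,
    RelEmbedding.coe_trans, homEquiv_doubleInr, homEquiv_doubleInr, homEquiv_doubleMap]
  funext i
  simp

/-- The folding map `[n] * [n] → [n]` on vertices. -/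
def foldIdx (n : SemiSimplexCategory) : Fin ((double n).len + 1) → Fin (n.len + 1) :=
  Sum.elim id id ∘ (doubleIdx n).symm

/-- The map `[n] * [n] → [1]` on vertices. -/
def heightIdx (n : SemiSimplexCategory) : Fin ((double n).len + 1) → Fin 2 :=
  Sum.elim (fun _ => 0) (fun _ => 1) ∘ (doubleIdx n).symm

/-! ### Combinatorics of the folding map and the height on vertices -/

section Vertices

open SemiSimplexCategory

theorem foldIdx_doubleInl (n : SemiSimplexCategory) : foldIdx n ∘ homEquiv (doubleInl n) = id := by
  rw [homEquiv_doubleInl]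
  funext i
  simp [foldIdx]

theorem foldIdx_doubleInr (n : SemiSimplexCategory) : foldIdx n ∘ homEquiv (doubleInr n) = id := by
  rw [homEquiv_doubleInr]
  funext i
  simp [foldIdx]

theorem foldIdx_doubleMap {m n : SemiSimplexCategory} (ψ : m ⟶ n) :
    foldIdx n ∘ homEquiv (doubleMap ψ) = homEquiv ψ ∘ foldIdx m := by
  rw [homEquiv_doubleMap]
  funext i
  obtain ⟨i, rfl⟩ := (doubleIdx m).surjective i
  rcases i with i | i <;> simp [foldIdx]

theorem heightIdx_doubleInl (n : SemiSimplexCategory) :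
    heightIdx n ∘ homEquiv (doubleInl n) = fun _ => 0 := by
  rw [homEquiv_doubleInl]
  funext i
  simp [heightIdx]

theorem heightIdx_doubleInr (n : SemiSimplexCategory) :
    heightIdx n ∘ homEquiv (doubleInr n) = fun _ => 1 := by
  rw [homEquiv_doubleInr]
  funext i
  simp [heightIdx]

theorem heightIdx_doubleMap {m n : SemiSimplexCategory} (ψ : m ⟶ n) :
    heightIdx n ∘ homEquiv (doubleMap ψ) = heightIdx m := by
  rw [homEquiv_doubleMap]
  funext i
  obtain ⟨i, rfl⟩ := (doubleIdx m).surjective i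
  rcases i with i | i <;> simp [heightIdx]

end Vertices

/-- The folding map `Δ^n * Δ^n → Δ^n`. -/
def fold (n : SemiSimplexCategory) : C(SSimp (double n), SSimp n) :=
  -- The vertex map `foldIdx n` is not monotone, so this is no simplicial operator. A bivariant
  -- theory can still be pulled back along it, and only continuity is needed.
  ⟨stdSimplex.map (foldIdx n), stdSimplex.continuous_map _⟩

/-- The join coordinate `Δ^n * Δ^n → [0, 1]`. -/
def height (n : SemiSimplexCategory) : C(SSimp (double n), unitInterval) :=
  -- This measures the barycentric weight on the second copy of `[n]`.
  ⟨fun u => stdSimplexHomeomorphUnitInterval (stdSimplex.map (heightIdx n) u),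
    stdSimplexHomeomorphUnitInterval.continuous.comp (stdSimplex.continuous_map _)⟩

theorem stdSimplex_map_const {ι κ : Type*} [Fintype ι] [Fintype κ] [DecidableEq κ] (k : κ)
    (t : stdSimplex ℝ ι) : stdSimplex.map (fun _ => k) t = stdSimplex.vertex k := by
  ext j
  rw [stdSimplex.map_coe, FunOnFinite.linearMap_apply_apply, stdSimplex.vertex_coe]
  by_cases h : k = j
  · subst h
    simp
  · simp [h, Ne.symm h]

/-- Reduces identities between affine maps of simplices to identities between vertex maps; `k` need
not be monotone. -/
theorem map_comp_SSimp_map {m n : SemiSimplexCategory} {κ : Type} [Fintype κ] (ψ : m ⟶ n)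
    (k : Fin (n.len + 1) → κ) (k' : Fin (m.len + 1) → κ)
    (h : k ∘ SemiSimplexCategory.homEquiv ψ = k') (t : SSimp m) :
    stdSimplex.map k (SSimp.map ψ t) = stdSimplex.map k' t :=
  (stdSimplex.map_comp_apply _ _ _).trans (congrArg (fun k => stdSimplex.map k t) h)

/-- On the two copies of `Δ^n` the pair (`fold`, `height`) is `(id, 0)` and `(id, 1)`, as on the two
ends of a prism. Together with naturality under `doubleMap`, this is all that is used of the join.
-/
theorem fold_inl (n : SemiSimplexCategory) (t : SSimp n) :
    fold n (SSimp.map (doubleInl n) t) = t :=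
  (map_comp_SSimp_map _ _ _ (foldIdx_doubleInl n) t).trans (stdSimplex.map_id_apply t)

theorem fold_inr (n : SemiSimplexCategory) (t : SSimp n) :
    fold n (SSimp.map (doubleInr n) t) = t :=
  (map_comp_SSimp_map _ _ _ (foldIdx_doubleInr n) t).trans (stdSimplex.map_id_apply t)

theorem fold_doubleMap {m n : SemiSimplexCategory} (ψ : m ⟶ n) (u : SSimp (double m)) :
    fold n (SSimp.map (doubleMap ψ) u) = SSimp.map ψ (fold m u) :=
  (map_comp_SSimp_map _ _ _ (foldIdx_doubleMap ψ) u).trans (stdSimplex.map_comp_apply _ _ u).symm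

theorem height_inl (n : SemiSimplexCategory) (t : SSimp n) :
    height n (SSimp.map (doubleInl n) t) = 0 := by
  refine (congrArg stdSimplexHomeomorphUnitInterval
    ((map_comp_SSimp_map _ _ _ (heightIdx_doubleInl n) t).trans
      (stdSimplex_map_const (0 : Fin 2) t))).trans ?_
  exact stdSimplexHomeomorphUnitInterval_zero

theorem height_inr (n : SemiSimplexCategory) (t : SSimp n) :
    height n (SSimp.map (doubleInr n) t) = 1 := by
  refine (congrArg stdSimplexHomeomorphUnitInterval
    ((map_comp_SSimp_map _ _ _ (heightIdx_doubleInr n) t).trans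
      (stdSimplex_map_const (1 : Fin 2) t))).trans ?_
  exact stdSimplexHomeomorphUnitInterval_one

theorem height_doubleMap {m n : SemiSimplexCategory} (ψ : m ⟶ n) (u : SSimp (double m)) :
    height n (SSimp.map (doubleMap ψ) u) = height m u :=
  congrArg stdSimplexHomeomorphUnitInterval
    (map_comp_SSimp_map _ _ _ (heightIdx_doubleMap ψ) u)

/-- The straight line homotopy `Δ^n × [0, 1] → Δ^n * Δ^n` between the two inclusions. -/
def slide (n : SemiSimplexCategory) : C(SSimp n × unitInterval, SSimp (double n)) where
  toFun z := ⟨(1 - (z.2 : ℝ)) • (SSimp.map (doubleInl n) z.1).1 +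
      (z.2 : ℝ) • (SSimp.map (doubleInr n) z.1).1,
    convex_stdSimplex ℝ _ (SSimp.map (doubleInl n) z.1).2 (SSimp.map (doubleInr n) z.1).2
      (by linarith [z.2.2.2]) z.2.2.1 (by ring)⟩
  continuous_toFun := by
    refine Continuous.subtype_mk ?_ _
    have h₁ : Continuous fun z : SSimp n × unitInterval => (SSimp.map (doubleInl n) z.1).1 := by
      fun_prop
    have h₂ : Continuous fun z : SSimp n × unitInterval => (SSimp.map (doubleInr n) z.1).1 := by
      fun_prop
    fun_prop

theorem slide_zero (n : SemiSimplexCategory) (t : SSimp n) :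
    slide n (t, 0) = SSimp.map (doubleInl n) t := by
  apply Subtype.ext
  change (1 - (0 : ℝ)) • (SSimp.map (doubleInl n) t).1 + (0 : ℝ) • (SSimp.map (doubleInr n) t).1 = _
  simp

theorem slide_one (n : SemiSimplexCategory) (t : SSimp n) :
    slide n (t, 1) = SSimp.map (doubleInr n) t := by
  apply Subtype.ext
  change (1 - (1 : ℝ)) • (SSimp.map (doubleInl n) t).1 + (1 : ℝ) • (SSimp.map (doubleInr n) t).1 = _
  simp

theorem SSimp.map_map {l m n : SemiSimplexCategory} (φ : l ⟶ m) (ψ : m ⟶ n) (t : SSimp l) :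
    SSimp.map ψ (SSimp.map φ t) = SSimp.map (φ ≫ ψ) t := by
  rw [SSimp.map, SSimp.map, SSimp.map, Functor.map_comp, Simp.map_comp]
  rfl

/-- Maps induced on simplices are affine, so only the endpoints of the segments matter, and these
are natural because both inclusions are. -/
theorem slide_naturality {m n : SemiSimplexCategory} (ψ : m ⟶ n) (t : SSimp m)
    (s : unitInterval) :
    slide n (SSimp.map ψ t, s) = SSimp.map (doubleMap ψ) (slide m (t, s)) := by
  apply Subtype.ext
  change (1 - (s : ℝ)) • (SSimp.map (doubleInl n) (SSimp.map ψ t)).1 +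
      (s : ℝ) • (SSimp.map (doubleInr n) (SSimp.map ψ t)).1 =
    FunOnFinite.linearMap ℝ ℝ _ ((1 - (s : ℝ)) • (SSimp.map (doubleInl m) t).1 +
      (s : ℝ) • (SSimp.map (doubleInr m) t).1)
  rw [map_add, map_smul, map_smul, SSimp.map_map, SSimp.map_map, ← doubleInl_comp_doubleMap,
    ← doubleInr_comp_doubleMap, ← SSimp.map_map, ← SSimp.map_map]
  rfl

end Double

/-! ## Homotopies between maps of fat realizations -/

section FatRealization

/-- Maps `H_n : X_n → Y([n] * [n])`, natural in injective maps `[m] → [n]`, induce a homotopy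
between the realizations of the maps `X → Y` obtained by restriction to the two copies of `[n]`. -/
theorem fatRealization_map_homotopic {X Y : SemiSimplexCategoryᵒᵖ ⥤ TopCat.{u}} (f g : X ⟶ Y)
    (H : ∀ n : SemiSimplexCategory, X.obj (op n) ⟶ Y.obj (op (double n)))
    (nat : ∀ {m n : SemiSimplexCategory} (ψ : m ⟶ n),
      X.map ψ.op ≫ H m = H n ≫ Y.map (doubleMap ψ).op)
    (hf : ∀ n, H n ≫ Y.map (doubleInl n).op = f.app (op n))
    (hg : ∀ n, H n ≫ Y.map (doubleInr n).op = g.app (op n)) :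
    (fatRealization.map f).hom.Homotopic (fatRealization.map g).hom := by
  -- The point `(x, t)` moves along the segment `slide n (t, ·)` inside the simplex `H n x`. The
  -- homotopy is built as a map into the path space, so that it descends to the quotient without
  -- asking whether the product of a quotient map with `[0, 1]` is again a quotient map.
  let Φ : (Σ n : SemiSimplexCategory, X.obj (op n) × SSimp n) →
      C(unitInterval, fatRealization.obj Y) := fun z =>
    ⟨fun s => Quot.mk _ ⟨double z.1, H z.1 z.2.1, slide z.1 (z.2.2, s)⟩, by
      exact continuous_quot_mk.comp ((continuous_sigmaMk (i := double z.1)).comp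
        (continuous_const.prodMk ((slide z.1).continuous.comp
          (continuous_const.prodMk continuous_id))))⟩
  have hΦ : Continuous Φ := by
    refine continuous_sigma fun n => ?_
    refine ContinuousMap.continuous_of_continuous_uncurry _ ?_
    exact continuous_quot_mk.comp ((continuous_sigmaMk (i := double n)).comp
      (((H n).hom.continuous.comp (continuous_fst.comp continuous_fst)).prodMk
        ((slide n).continuous.comp
          ((continuous_snd.comp continuous_fst).prodMk continuous_snd))))
  have hrel : ∀ a b, FatRel X a b → Φ a = Φ b := by
    rintro _ _ ⟨ψ, x, t⟩
    ext s
    change Quot.mk (FatRel Y) _ = Quot.mk (FatRel Y) _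
    have h := ConcreteCategory.congr_hom (nat ψ) x
    simp only [TopCat.comp_app] at h
    -- The two tracks are identified pointwise by the face relation along `doubleMap ψ`.
    have h' := Quot.sound (FatRel.face (X := Y) (doubleMap ψ) (H _ x) (slide _ (t, s)))
    rw [← h] at h'
    refine h'.trans ?_
    dsimp only
    rw [← slide_naturality ψ t s]
  let Ψ : C(fatRealization.obj X, C(unitInterval, fatRealization.obj Y)) :=
    ⟨Quot.lift Φ hrel, continuous_quot_lift _ hΦ⟩
  refine ⟨⟨⟨fun z => Ψ z.2 z.1, ?_⟩, ?_, ?_⟩⟩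
  · exact (ContinuousMap.continuous_uncurry_of_continuous Ψ).comp continuous_swap
  · intro z
    induction z using Quot.ind with | _ z
    obtain ⟨n, x, t⟩ := z
    change Quot.mk (FatRel Y) ⟨double n, H n x, slide n (t, 0)⟩ =
      Quot.mk (FatRel Y) ⟨n, f.app (op n) x, t⟩
    -- At time `0` the point lies on the face formed by the first copy of `[n]`, where `H n x`
    -- restricts to `f x`.
    rw [slide_zero, ← hf n]
    exact (Quot.sound (FatRel.face (X := Y) (doubleInl n) (H n x) t)).symm
  · intro z
    induction z using Quot.ind with | _ z
    obtain ⟨n, x, t⟩ := z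
    change Quot.mk (FatRel Y) ⟨double n, H n x, slide n (t, 1)⟩ =
      Quot.mk (FatRel Y) ⟨n, g.app (op n) x, t⟩
    rw [slide_one, ← hg n]
    exact (Quot.sound (FatRel.face (X := Y) (doubleInr n) (H n x) t)).symm

end FatRealization

/-! ### Pull-back squares over simplices and intervals, and fiberwise homotopies -/

section Squares

variable {d : ℕ} {B B' : Type u} [TopologicalSpace B] [TopologicalSpace B']

/-- A commutative square with continuous factorizations, unique on points, is a pull-back. -/
def PullSquare.ofLift {θ' : TangentialStructure d B'} {θ : TangentialStructure d B}
    (f : C(B', B)) (F : C(θ'.X, θ.X))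
    (comm : ∀ x, θ.map (F x) = ((θ'.map x).1, f (θ'.map x).2))
    (inj : ∀ x y, F x = F y → θ'.map x = θ'.map y → x = y)
    (lift : ∀ (Z : Type u) [TopologicalSpace Z] (x : C(Z, θ.X)) (y : C(Z, BO d × B')),
      (∀ z, θ.map (x z) = ((y z).1, f (y z).2)) →
      ∃ l : C(Z, θ'.X), (∀ z, F (l z) = x z) ∧ ∀ z, θ'.map (l z) = y z) :
    PullSquare θ' θ where
  f := f
  F := F
  isPullback := by
    have key (s : Limits.PullbackCone (TopCat.ofHom θ.map)
        (TopCat.ofHom ((ContinuousMap.id (BO d)).prodMap f))) :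
        ∃ l : C(s.pt, θ'.X), (∀ z, F (l z) = s.fst.hom z) ∧ ∀ z, θ'.map (l z) = s.snd.hom z :=
      lift s.pt s.fst.hom s.snd.hom fun z => ConcreteCategory.congr_hom s.condition z
    choose l h₁ h₂ using key
    exact ⟨⟨TopCat.ext comm⟩, ⟨Limits.PullbackCone.IsLimit.mk _ (fun s => TopCat.ofHom (l s))
      (fun s => TopCat.ext (h₁ s)) (fun s => TopCat.ext (h₂ s))
      (fun s k e₁ e₂ => TopCat.ext fun z => inj _ _
        ((ConcreteCategory.congr_hom e₁ z).trans (h₁ s z).symm)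
        ((ConcreteCategory.congr_hom e₂ z).trans (h₂ s z).symm))⟩⟩

/-- `θ × id_K : X × K → BO(d) × (B × K)`. -/
def TangentialStructure.prodTop (θ : TangentialStructure d B) (K : Type) [TopologicalSpace K] :
    TangentialStructure d (B × K) where
  X := θ.X × K
  map := ⟨fun z => ((θ.map z.1).1, (θ.map z.1).2, z.2), by fun_prop⟩
  fibration := by
    intro Y _ H h₀ hH
    have hH' : ∀ y, ((θ.map (h₀ y).1).1, (θ.map (h₀ y).1).2, (h₀ y).2) = H (y, 0) := hH
    obtain ⟨G, hG, hG₀⟩ := θ.fibration Y ⟨fun z => ((H z).1, (H z).2.1), by fun_prop⟩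
      ⟨fun y => (h₀ y).1, by fun_prop⟩ (fun y => by
        change θ.map (h₀ y).1 = ((H (y, 0)).1, (H (y, 0)).2.1)
        rw [← hH' y])
    refine ⟨⟨fun z => (G z, (H z).2.2), by fun_prop⟩, fun z => ?_, fun y => ?_⟩
    · change ((θ.map (G z)).1, (θ.map (G z)).2, (H z).2.2) = H z
      rw [hG z]
      rfl
    · change (G (y, 0), (H (y, 0)).2.2) = h₀ y
      rw [hG₀, ← hH' y]
      rfl

/-- `θ × id` is pulled back from `θ × id` along the product of the identity with a map of
simplices, not necessarily simplicial. -/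
def PullSquare.simpMap (θ : TangentialStructure d B) {k l : SimplexCategory}
    (c : C(Simp k, Simp l)) : PullSquare (θ.prodSimp k) (θ.prodSimp l) :=
  .ofLift ((ContinuousMap.id B).prodMap c) ((ContinuousMap.id θ.X).prodMap c)
    (fun _ => rfl)
    (fun _ _ h h' => Prod.ext (congrArg (fun w : θ.X × Simp l => w.1) h)
      (congrArg (fun w : BO d × B × Simp k => w.2.2) h'))
    (fun Z _ x y h => by
      have h' : ∀ z, ((θ.map (x z).1).1, (θ.map (x z).1).2, (x z).2) =
        ((y z).1, (y z).2.1, c (y z).2.2) := h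
      refine ⟨⟨fun z => ((x z).1, (y z).2.2), by fun_prop⟩, fun z => Prod.ext rfl ?_,
        fun z => Prod.ext ?_ (Prod.ext ?_ rfl)⟩
      · exact (congrArg (fun w => w.2.2) (h' z)).symm
      · exact congrArg (fun w => w.1) (h' z)
      · exact congrArg (fun w => w.2.1) (h' z))

/-- The projection square `θ × id_{[0,1]} → θ`. -/
def PullSquare.proj (θ : TangentialStructure d B) : PullSquare (θ.prodTop unitInterval) θ :=
  .ofLift ⟨fun z => z.1, by fun_prop⟩ ⟨fun z => z.1, continuous_fst⟩
    (fun _ => rfl)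
    (fun _ _ h h' => Prod.ext h (congrArg (fun w : BO d × B × unitInterval => w.2.2) h'))
    (fun Z _ x y h => by
      refine ⟨(⟨fun z => (x z, (y z).2.2), by fun_prop⟩ : C(Z, θ.X × unitInterval)),
        fun z => rfl, fun z => ?_⟩
      have h' := h z
      exact Prod.ext (congrArg (fun w => w.1) h') (Prod.ext (congrArg (fun w => w.2) h') rfl))

/-- The inclusion square `θ → θ × id_{[0,1]}` at `r`. -/
def PullSquare.incl (θ : TangentialStructure d B) (r : unitInterval) :
    PullSquare θ (θ.prodTop unitInterval) :=
  .ofLift ⟨fun z => (z, r), by fun_prop⟩ ⟨fun z => (z, r), by fun_prop⟩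
    (fun _ => rfl)
    (fun _ _ h _ => congrArg (fun w : θ.X × unitInterval => w.1) h)
    (fun Z _ x y h => by
      have h' : ∀ z, ((θ.map (x z).1).1, (θ.map (x z).1).2, (x z).2) = ((y z).1, (y z).2, r) := h
      refine ⟨⟨fun z => (x z).1, by fun_prop⟩, fun z => ?_, fun z => ?_⟩
      · exact Prod.ext rfl (congrArg (fun w => w.2.2) (h' z)).symm
      · exact Prod.ext (congrArg (fun w => w.1) (h' z)) (congrArg (fun w => w.2.1) (h' z)))

/-- The map `(x, r, u) ↦ (x, r * a u, c u)` is a pull-back square. -/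
def PullSquare.scale (θ : TangentialStructure d B) {k l : SimplexCategory}
    (c : C(Simp k, Simp l)) (a : C(Simp k, unitInterval)) :
    PullSquare ((θ.prodTop unitInterval).prodSimp k) ((θ.prodTop unitInterval).prodSimp l) :=
  -- Multiplication by `a` runs the linear contraction of `[0, 1]`: it is the contraction to `0`
  -- where `a = 0` and the identity where `a = 1`. The coordinate in `X` is untouched, which makes
  -- the square a pull-back.
  .ofLift ⟨fun z => ((z.1.1, z.1.2 * a z.2), c z.2), by fun_prop⟩
    ⟨fun z : (θ.X × unitInterval) × Simp k => ((z.1.1, z.1.2 * a z.2), c z.2), by fun_prop⟩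
    (fun _ => rfl)
    (fun _ _ h h' => Prod.ext (Prod.ext
        (congrArg (fun w : (θ.X × unitInterval) × Simp l => w.1.1) h)
        (congrArg (fun w : BO d × (B × unitInterval) × Simp k => w.2.1.2) h'))
      (congrArg (fun w : BO d × (B × unitInterval) × Simp k => w.2.2) h'))
    (fun Z _ (x : C(Z, (θ.X × unitInterval) × Simp l)) y h => by
      have h' : ∀ z, ((θ.map (x z).1.1).1, ((θ.map (x z).1.1).2, (x z).1.2), (x z).2) =
        ((y z).1, ((y z).2.1.1, (y z).2.1.2 * a (y z).2.2), c (y z).2.2) := h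
      refine ⟨(⟨fun z => (((x z).1.1, (y z).2.1.2), (y z).2.2), by fun_prop⟩ :
        C(Z, (θ.X × unitInterval) × Simp k)), fun z => Prod.ext (Prod.ext rfl ?_) ?_,
        fun z => Prod.ext ?_ (Prod.ext (Prod.ext ?_ rfl) rfl)⟩
      · exact (congrArg (fun w => w.2.1.2) (h' z)).symm
      · exact (congrArg (fun w => w.2.2) (h' z)).symm
      · exact congrArg (fun w => w.1) (h' z)
      · exact congrArg (fun w => w.2.1.1) (h' z))

/-- A fiberwise homotopy between fiberwise maps. -/
structure PushHomotopy {θ η : TangentialStructure d B} (g₀ g₁ : PushMap θ η) where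
  map : C(θ.X × unitInterval, η.X)
  comm : ∀ z, η.map (map z) = θ.map z.1
  zero : ∀ x, map (x, 0) = g₀.map x
  one : ∀ x, map (x, 1) = g₁.map x

/-- The fiberwise map `(x, u) ↦ (h (x, a u), u)` for a fiberwise homotopy `h`. -/
def PushHomotopy.along {θ η : TangentialStructure d B} {g₀ g₁ : PushMap θ η}
    (h : PushHomotopy g₀ g₁) {k : SimplexCategory} (a : C(Simp k, unitInterval)) :
    PushMap (θ.prodSimp k) (η.prodSimp k) where
  map := ⟨fun z => (h.map (z.1, a z.2), z.2), by fun_prop⟩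
  comm z := by
    change ((η.map (h.map (z.1, a z.2))).1, (η.map (h.map (z.1, a z.2))).2, z.2) =
      ((θ.map z.1).1, (θ.map z.1).2, z.2)
    rw [h.comm]

end Squares

/-! ### Naturality of the simplexwise homotopies in a bivariant theory -/

section Naturality

variable {d : ℕ} {A : Type v} [Category.{w} A] (F : BivariantTheory.{u} d A) {B : Type u}
  [TopologicalSpace B] {θ η : TangentialStructure d B} {j k l m : SimplexCategory}

/-- The restriction moves past the push-forward because the two operations commute, and then merges
with the first pull-back by functoriality. -/
theorem BivariantTheory.simpMap_along_restrict {g₀ g₁ : PushMap θ η} (h : PushHomotopy g₀ g₁)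
    (c : C(Simp k, Simp l)) (a : C(Simp k, unitInterval)) (φ : j ⟶ k) :
    (F.pull (PullSquare.simpMap θ c) ≫ F.push (h.along a)) ≫ F.pull ((PullSquare.id η).prodSimp φ) =
      F.pull (PullSquare.simpMap θ (c.comp (Simp.map φ))) ≫
        F.push (h.along (a.comp (Simp.map φ))) := by
  rw [Category.assoc, F.push_pull ((PullSquare.id θ).prodSimp φ) _ _
    (h.along (a.comp (Simp.map φ))) rfl rfl, ← Category.assoc, ← F.pull_comp]
  rfl

theorem BivariantTheory.pull_simpMap_id :
    F.pull (PullSquare.simpMap θ (.id (Simp k))) = 𝟙 _ :=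
  F.pull_id (θ.prodSimp k)

theorem PushHomotopy.along_zero {g₀ g₁ : PushMap θ η} (h : PushHomotopy g₀ g₁)
    {a : C(Simp k, unitInterval)} (ha : ∀ t, a t = 0) : h.along a = g₀.prodSimp k :=
  PushMap.ext (ContinuousMap.ext fun z => Prod.ext
    ((congrArg (fun s => h.map (z.1, s)) (ha z.2)).trans (h.zero z.1)) rfl)

theorem PushHomotopy.along_one {g₀ g₁ : PushMap θ η} (h : PushHomotopy g₀ g₁)
    {a : C(Simp k, unitInterval)} (ha : ∀ t, a t = 1) : h.along a = g₁.prodSimp k :=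
  PushMap.ext (ContinuousMap.ext fun z => Prod.ext
    ((congrArg (fun s => h.map (z.1, s)) (ha z.2)).trans (h.one z.1)) rfl)

/-- Both sides are one pull-back followed by one push-forward, and `hc` and `ha` match the data.
With `fold` and `height` inserted, this is the hypothesis `nat` of `fatRealization_map_homotopic`.
-/
theorem BivariantTheory.simpMap_along_naturality {g₀ g₁ : PushMap θ η} (h : PushHomotopy g₀ g₁)
    {c : C(Simp k, Simp l)} {a : C(Simp k, unitInterval)} {c' : C(Simp j, Simp m)}
    {a' : C(Simp j, unitInterval)} (φ : l ⟶ m) (φ' : k ⟶ j)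
    (hc : ∀ t, c' (Simp.map φ' t) = Simp.map φ (c t)) (ha : ∀ t, a' (Simp.map φ' t) = a t) :
    F.pull ((PullSquare.id θ).prodSimp φ) ≫ F.pull (PullSquare.simpMap θ c) ≫ F.push (h.along a) =
      (F.pull (PullSquare.simpMap θ c') ≫ F.push (h.along a')) ≫
        F.pull ((PullSquare.id η).prodSimp φ') := by
  obtain rfl : a'.comp (Simp.map φ') = a := ContinuousMap.ext ha
  rw [F.simpMap_along_restrict h, show c'.comp (Simp.map φ') = (Simp.map φ).comp c from
    ContinuousMap.ext hc, ← Category.assoc, ← F.pull_comp]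
  rfl

theorem BivariantTheory.simpMap_along_restrict_zero {g₀ g₁ : PushMap θ η} (h : PushHomotopy g₀ g₁)
    {c : C(Simp k, Simp j)} {a : C(Simp k, unitInterval)} (φ : j ⟶ k)
    (hc : ∀ t, c (Simp.map φ t) = t) (ha : ∀ t, a (Simp.map φ t) = 0) :
    (F.pull (PullSquare.simpMap θ c) ≫ F.push (h.along a)) ≫ F.pull ((PullSquare.id η).prodSimp φ) =
      F.push (g₀.prodSimp j) := by
  rw [F.simpMap_along_restrict h, h.along_zero (a := a.comp (Simp.map φ)) ha,
    show c.comp (Simp.map φ) = .id _ from ContinuousMap.ext hc, F.pull_simpMap_id,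
    Category.id_comp]

theorem BivariantTheory.simpMap_along_restrict_one {g₀ g₁ : PushMap θ η} (h : PushHomotopy g₀ g₁)
    {c : C(Simp k, Simp j)} {a : C(Simp k, unitInterval)} (φ : j ⟶ k)
    (hc : ∀ t, c (Simp.map φ t) = t) (ha : ∀ t, a (Simp.map φ t) = 1) :
    (F.pull (PullSquare.simpMap θ c) ≫ F.push (h.along a)) ≫ F.pull ((PullSquare.id η).prodSimp φ) =
      F.push (g₁.prodSimp j) := by
  rw [F.simpMap_along_restrict h, h.along_one (a := a.comp (Simp.map φ)) ha,
    show c.comp (Simp.map φ) = .id _ from ContinuousMap.ext hc, F.pull_simpMap_id,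
    Category.id_comp]

theorem BivariantTheory.scale_restrict (c : C(Simp k, Simp l)) (a : C(Simp k, unitInterval))
    (φ : j ⟶ k) :
    F.pull (PullSquare.scale θ c a) ≫ F.pull ((PullSquare.id (θ.prodTop unitInterval)).prodSimp φ) =
      F.pull (PullSquare.scale θ (c.comp (Simp.map φ)) (a.comp (Simp.map φ))) := by
  rw [← F.pull_comp]
  rfl

theorem BivariantTheory.scale_naturality
    {c : C(Simp k, Simp l)} {a : C(Simp k, unitInterval)} {c' : C(Simp j, Simp m)}
    {a' : C(Simp j, unitInterval)} (φ : l ⟶ m) (φ' : k ⟶ j)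
    (hc : ∀ t, c' (Simp.map φ' t) = Simp.map φ (c t)) (ha : ∀ t, a' (Simp.map φ' t) = a t) :
    F.pull ((PullSquare.id (θ.prodTop unitInterval)).prodSimp φ) ≫ F.pull (PullSquare.scale θ c a) =
      F.pull (PullSquare.scale θ c' a') ≫
        F.pull ((PullSquare.id (θ.prodTop unitInterval)).prodSimp φ') := by
  obtain rfl : a'.comp (Simp.map φ') = a := ContinuousMap.ext ha
  rw [F.scale_restrict, show c'.comp (Simp.map φ') = (Simp.map φ).comp c from
    ContinuousMap.ext hc, ← F.pull_comp]
  rfl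

theorem PullSquare.scale_zero {a : C(Simp k, unitInterval)} (ha : ∀ t, a t = 0) :
    PullSquare.scale θ (.id (Simp k)) a =
      ((PullSquare.proj θ).comp (PullSquare.incl θ 0)).prodSimp (𝟙 k) := by
  have h : ∀ (r : unitInterval) t, r * a t = 0 := fun r t => by rw [ha, mul_zero]
  apply PullSquare.ext
  · exact ContinuousMap.ext fun z => Prod.ext (Prod.ext rfl (h _ _))
      (DFunLike.congr_fun (Simp.map_id k) z.2).symm
  · exact ContinuousMap.ext fun z => Prod.ext (Prod.ext rfl (h _ _))
      (DFunLike.congr_fun (Simp.map_id k) z.2).symm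

theorem PullSquare.scale_one {a : C(Simp k, unitInterval)} (ha : ∀ t, a t = 1) :
    PullSquare.scale θ (.id (Simp k)) a =
      (PullSquare.id (θ.prodTop unitInterval)).prodSimp (𝟙 k) := by
  have h : ∀ (r : unitInterval) t, r * a t = r := fun r t => by rw [ha, mul_one]
  apply PullSquare.ext
  · exact ContinuousMap.ext fun z => Prod.ext (Prod.ext rfl (h _ _))
      (DFunLike.congr_fun (Simp.map_id k) z.2).symm
  · exact ContinuousMap.ext fun z => Prod.ext (Prod.ext rfl (h _ _))
      (DFunLike.congr_fun (Simp.map_id k) z.2).symm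

theorem BivariantTheory.scale_restrict_zero {c : C(Simp k, Simp j)} {a : C(Simp k, unitInterval)}
    (φ : j ⟶ k) (hc : ∀ t, c (Simp.map φ t) = t) (ha : ∀ t, a (Simp.map φ t) = 0) :
    F.pull (PullSquare.scale θ c a) ≫ F.pull ((PullSquare.id (θ.prodTop unitInterval)).prodSimp φ) =
      F.pull (((PullSquare.proj θ).comp (PullSquare.incl θ 0)).prodSimp (𝟙 j)) := by
  rw [F.scale_restrict, show c.comp (Simp.map φ) = .id _ from ContinuousMap.ext hc,
    PullSquare.scale_zero (a := a.comp (Simp.map φ)) ha]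

theorem BivariantTheory.scale_restrict_one {c : C(Simp k, Simp j)} {a : C(Simp k, unitInterval)}
    (φ : j ⟶ k) (hc : ∀ t, c (Simp.map φ t) = t) (ha : ∀ t, a (Simp.map φ t) = 1) :
    F.pull (PullSquare.scale θ c a) ≫ F.pull ((PullSquare.id (θ.prodTop unitInterval)).prodSimp φ) =
      F.pull ((PullSquare.id (θ.prodTop unitInterval)).prodSimp (𝟙 j)) := by
  rw [F.scale_restrict, show c.comp (Simp.map φ) = .id _ from ContinuousMap.ext hc,
    PullSquare.scale_one (a := a.comp (Simp.map φ)) ha]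

end Naturality

/-! ## The realization of the thickening -/

/-- The realization of the simplicial thickening of a bivariant theory with values in spaces. -/
def BivariantTheory.realization {d : ℕ} (F : BivariantTheory.{u} d TopCat.{v}) :
    BivariantTheory.{u} d TopCat.{v} :=
  F.thickening.postcomp simplicialFatRealization

section Realization

variable {d : ℕ} (F : BivariantTheory.{u} d TopCat.{v}) {B : Type u} [TopologicalSpace B]

/-- The semi-simplicial space whose fat realization is `F.realization.obj θ`. -/
abbrev BivariantTheory.semi (θ : TangentialStructure d B) : SemiSimplexCategoryᵒᵖ ⥤ TopCat.{v} :=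
  SemiSimplexCategory.toSimplexCategory.op ⋙ F.thickening.obj θ

/-- Fiberwise homotopic maps induce homotopic push-forwards. -/
theorem BivariantTheory.realization_push_homotopic {θ η : TangentialStructure d B}
    {g₀ g₁ : PushMap θ η} (h : PushHomotopy g₀ g₁) :
    (F.realization.push g₀).hom.Homotopic (F.realization.push g₁).hom :=
  fatRealization_map_homotopic (X := F.semi θ) (Y := F.semi η) _ _
    -- Spread the simplex over the join by `fold`, then apply the homotopy at time `height`.
    (fun n => F.pull (PullSquare.simpMap θ (fold n)) ≫ F.push (h.along (height n)))
    (fun ψ => F.simpMap_along_naturality h _ _ (fold_doubleMap ψ) (height_doubleMap ψ))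
    (fun n => F.simpMap_along_restrict_zero h _ (fold_inl n) (height_inl n))
    (fun n => F.simpMap_along_restrict_one h _ (fold_inr n) (height_inr n))

/-- The contraction of `[0, 1]` to `0` induces a self-map homotopic to the identity. -/
theorem BivariantTheory.realization_contract_homotopic (θ : TangentialStructure d B) :
    (F.realization.pull ((PullSquare.proj θ).comp (PullSquare.incl θ 0))).hom.Homotopic
      (F.realization.pull (PullSquare.id (θ.prodTop unitInterval))).hom :=
  fatRealization_map_homotopic (X := F.semi (θ.prodTop unitInterval))
    (Y := F.semi (θ.prodTop unitInterval)) _ _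
    -- Here the homotopy acts on the base, so a single pull-back does the work of both operations.
    (fun n => F.pull (PullSquare.scale θ (fold n) (height n)))
    (fun ψ => F.scale_naturality _ _ (fold_doubleMap ψ) (height_doubleMap ψ))
    (fun n => F.scale_restrict_zero _ (fold_inl n) (height_inl n))
    (fun n => F.scale_restrict_one _ (fold_inr n) (height_inr n))

end Realization

/-! ## Fiberwise homotopy equivalences -/

section Fiberwise

variable {d : ℕ} {B B' : Type u} [TopologicalSpace B] [TopologicalSpace B']

/-- The equivalence relation of fiberwise homotopy. -/
abbrev PushMap.Homotopic {θ η : TangentialStructure d B} : PushMap θ η → PushMap θ η → Prop :=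
  Relation.EqvGen fun g₀ g₁ => Nonempty (PushHomotopy g₀ g₁)

theorem PushMap.Homotopic.map {θ η : TangentialStructure d B} {g₀ g₁ : PushMap θ η}
    (h : PushMap.Homotopic g₀ g₁) : g₀.map.Homotopic g₁.map := by
  induction h with
  | rel _ _ h =>
    obtain ⟨h⟩ := h
    exact ⟨⟨h.map.comp ⟨Prod.swap, continuous_swap⟩, h.zero, h.one⟩⟩
  | refl => exact .refl _
  | symm _ _ _ h => exact h.symm
  | trans _ _ _ _ _ h₁ h₂ => exact h₁.trans h₂

/-- The map `s ↦ |1 - 2 s|` of the unit interval. -/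
def bounce : C(unitInterval, unitInterval) :=
  ⟨fun s => ⟨|1 - 2 * (s : ℝ)|, abs_nonneg _, abs_le.2 ⟨by linarith [s.2.2], by linarith [s.2.1]⟩⟩,
    by fun_prop⟩

theorem bounce_zero : bounce 0 = 1 := Subtype.ext (by simp [bounce])

theorem bounce_one : bounce 1 = 1 := Subtype.ext (by norm_num [bounce])

/-- A fiberwise self-map of a fibration that is homotopic to the identity has a fiberwise right
homotopy inverse. -/
theorem PushMap.exists_right_inverse_of_homotopic_id {θ : TangentialStructure d B}
    (f : PushMap θ θ) (hf : f.map.Homotopic (.id _)) :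
    ∃ e : PushMap θ θ, PushMap.Homotopic (e.comp f) (PushMap.id θ) := by
  obtain ⟨h⟩ := hf
  -- Lift the projection of `h` starting at the identity; this is possible because `f` is fiberwise.
  -- The end `e` of the lift is fiberwise since `h` ends at the identity.
  obtain ⟨k, hk, hk₀⟩ := θ.fibration θ.X ⟨fun z => θ.map (h (z.2, z.1)), by fun_prop⟩ (.id _)
    (fun x => by
      change θ.map x = θ.map (h (0, x))
      rw [h.apply_zero, f.comm])
  replace hk : ∀ x s, θ.map (k (x, s)) = θ.map (h (s, x)) := fun x s => hk (x, s)
  replace hk₀ : ∀ x, k (x, 0) = x := hk₀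
  let e : PushMap θ θ := ⟨⟨fun x => k (x, 1), by fun_prop⟩, fun x => by
    change θ.map (k (x, 1)) = _
    rw [hk, h.apply_one]
    rfl⟩
  let k' : ContinuousMap.Homotopy f.map (f.map.comp e.map) :=
    ⟨⟨fun z => f.map (k (z.2, z.1)), by fun_prop⟩,
      fun x => congrArg f.map (hk₀ x), fun x => rfl⟩
  -- A homotopy from `f ∘ e` to `f` and on to the identity. It is not fiberwise, but its projection
  -- runs along `θ ∘ h` from time `1` to time `0` and back, at time `bounce s`.
  let J := k'.symm.trans h
  have hJ : ∀ s x, θ.map (J (s, x)) = θ.map (h (bounce s, x)) := by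
    intro s x
    change θ.map ((k'.symm.trans h) (s, x)) = _
    rw [ContinuousMap.Homotopy.trans_apply]
    split_ifs with hs
    · rw [ContinuousMap.Homotopy.symm_apply]
      change θ.map (f.map (k (x, _))) = _
      rw [f.comm, hk]
      congr 3
      apply Subtype.ext
      change 1 - 2 * (s : ℝ) = |1 - 2 * (s : ℝ)|
      have hs' : (s : ℝ) ≤ 1 / 2 := hs
      rw [abs_of_nonneg (by linarith)]
    · congr 3
      apply Subtype.ext
      change 2 * (s : ℝ) - 1 = |1 - 2 * (s : ℝ)|
      have hs' : ¬ (s : ℝ) ≤ 1 / 2 := hs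
      rw [abs_of_nonpos (by linarith)]
      ring
  -- The there-and-back path is contracted in the base through `max (bounce s) t`, which equals `1`
  -- on the sides `s = 0`, `s = 1` and `t = 1`. Lift this contraction starting at `J`.
  obtain ⟨L, hL, hL₀⟩ := θ.fibration (θ.X × unitInterval)
    ⟨fun z => θ.map (h (max (bounce z.1.2) z.2, z.1.1)), by fun_prop⟩
    ⟨fun z => J (z.2, z.1), by fun_prop⟩ (fun z => by
      change θ.map (J (z.2, z.1)) = θ.map (h (max (bounce z.2) 0, z.1))
      rw [hJ, max_eq_left unitInterval.nonneg'])
  replace hL : ∀ x s t, max (bounce s) t = 1 → θ.map (L ((x, s), t)) = θ.map x := fun x s t hst =>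
    (hL ((x, s), t)).trans (by
      change θ.map (h (max (bounce s) t, x)) = _
      rw [hst, h.apply_one]
      rfl)
  replace hL₀ : ∀ x s, L ((x, s), 0) = J (s, x) := fun x s => hL₀ (x, s)
  have h₀ : ∀ t, max (bounce 0) t = 1 := fun t => by
    rw [bounce_zero, max_eq_left unitInterval.le_one']
  have h₁ : ∀ t, max (bounce 1) t = 1 := fun t => by
    rw [bounce_one, max_eq_left unitInterval.le_one']
  have h₂ : ∀ s, max (bounce s) 1 = 1 := fun s => max_eq_right unitInterval.le_one'
  let g₀ : PushMap θ θ := ⟨⟨fun x => L ((x, 0), 1), by fun_prop⟩, fun x => hL x 0 1 (h₀ 1)⟩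
  let g₁ : PushMap θ θ := ⟨⟨fun x => L ((x, 1), 1), by fun_prop⟩, fun x => hL x 1 1 (h₁ 1)⟩
  -- On these three sides `L` is fiberwise; traversed in order, they lead from `f ∘ e` to the
  -- identity.
  refine ⟨e, .trans _ g₀ _ (.rel _ _ ⟨?_⟩) (.trans _ g₁ _ (.rel _ _ ⟨?_⟩)
    (.symm _ _ (.rel _ _ ⟨?_⟩)))⟩
  · exact ⟨⟨fun z => L ((z.1, 0), z.2), by fun_prop⟩, fun z => hL _ _ _ (h₀ _),
      fun x => (hL₀ x 0).trans (J.apply_zero x), fun x => rfl⟩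
  · exact ⟨⟨fun z => L (z, 1), by fun_prop⟩, fun z => hL _ _ _ (h₂ _), fun x => rfl, fun x => rfl⟩
  · exact ⟨⟨fun z => L ((z.1, 1), z.2), by fun_prop⟩, fun z => hL _ _ _ (h₁ _),
      fun x => (hL₀ x 1).trans (J.apply_one x), fun x => rfl⟩

/-- A fiberwise map between fibrations that is a homotopy equivalence of total spaces has a
fiberwise right homotopy inverse (Dold). -/
theorem PushMap.exists_right_inverse {θ η : TangentialStructure d B} (g : PushMap θ η)
    (hg : IsHomotopyEquiv g.map) :
    ∃ g' : PushMap η θ, IsHomotopyEquiv g'.map ∧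
      PushMap.Homotopic (g'.comp g) (PushMap.id η) := by
  obtain ⟨k, -, ⟨h⟩⟩ := isHomotopyEquiv_iff.1 hg
  -- The homotopy inverse `k` is fiberwise only up to the projection of `h`. Lifting that homotopy
  -- deforms `k` to a fiberwise map `g₀`.
  obtain ⟨G, hG, hG₀⟩ := θ.fibration η.X ⟨fun z => η.map (h (z.2, z.1)), by fun_prop⟩ k
    (fun y => by
      change θ.map (k y) = η.map (h (0, y))
      rw [h.apply_zero, ContinuousMap.comp_apply, g.comm])
  let g₀ : PushMap η θ := ⟨⟨fun y => G (y, 1), by fun_prop⟩, fun y => (hG (y, 1)).trans (by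
    change η.map (h (1, y)) = η.map y
    rw [h.apply_one]
    rfl)⟩
  have hk : k.Homotopic g₀.map :=
    ⟨⟨G.comp ⟨Prod.swap, continuous_swap⟩, hG₀, fun y => rfl⟩⟩
  have hid : (g₀.comp g).map.Homotopic (.id _) :=
    ((ContinuousMap.Homotopic.refl g.map).comp hk.symm).trans ⟨h⟩
  -- Since `g ∘ g₀` has the fiberwise right inverse `e`, the map `g₀ ∘ e` is one for `g`.
  obtain ⟨e, he⟩ := PushMap.exists_right_inverse_of_homotopic_id (g₀.comp g) hid
  refine ⟨e.comp g₀, ?_, he⟩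
  exact isHomotopyEquiv_of_comp_left hg (isHomotopyEquiv_of_homotopic he.map.symm isHomotopyEquiv_id)

/-- The inclusion of the part over `B × {0}` of a fibration over `BO(d) × (B × [0, 1])` is a
homotopy equivalence. -/
theorem PullSquare.isHomotopyEquiv_F_of_zero {θ : TangentialStructure d (B × unitInterval)}
    {θ₀ : TangentialStructure d B} (p : PullSquare θ₀ θ) (hp : ∀ b, p.f b = (b, 0)) :
    IsHomotopyEquiv p.F := by
  -- Lift the contraction of `[0, 1]` to `0`, starting at the identity. Its end lies over `B × {0}`
  -- and defines the inverse `r`.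
  obtain ⟨k, hk, hk₀⟩ := θ.fibration θ.X
    ⟨fun z => ((θ.map z.1).1, (θ.map z.1).2.1, (θ.map z.1).2.2 * unitInterval.symm z.2),
      by fun_prop⟩ (.id _)
    (fun x => by
      change θ.map x = ((θ.map x).1, (θ.map x).2.1, (θ.map x).2.2 * unitInterval.symm 0)
      rw [unitInterval.symm_zero, mul_one])
  replace hk : ∀ x s, θ.map (k (x, s)) =
    ((θ.map x).1, (θ.map x).2.1, (θ.map x).2.2 * unitInterval.symm s) := fun x s => hk (x, s)
  replace hk₀ : ∀ x, k (x, 0) = x := hk₀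
  have hF : ∀ x, θ.map (p.F x) = ((θ₀.map x).1, (θ₀.map x).2, 0) := fun x => by
    rw [p.comm, hp]
  let r := p.lift (Z := θ.X) ⟨fun x => k (x, 1), by fun_prop⟩
    ⟨fun x => ((θ.map x).1, (θ.map x).2.1), by fun_prop⟩ (fun x => by
      change θ.map (k (x, 1)) = ((θ.map x).1, p.f (θ.map x).2.1)
      rw [hk, hp, unitInterval.symm_one, mul_zero])
  have hFr : ∀ x, p.F (r x) = k (x, 1) := fun x => p.F_lift _ _ _ x
  have hmr : ∀ x, θ₀.map (r x) = ((θ.map x).1, (θ.map x).2.1) := fun x => p.map_lift _ _ _ x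
  -- Over `B × {0}` the contraction of the base is constant, so `k` restricts to a homotopy on
  -- `θ₀.X`.
  let R := p.lift (Z := θ₀.X × unitInterval) ⟨fun z => k (p.F z.1, z.2), by fun_prop⟩
    ⟨fun z => θ₀.map z.1, by fun_prop⟩ (fun z => by
      change θ.map (k (p.F z.1, z.2)) = ((θ₀.map z.1).1, p.f (θ₀.map z.1).2)
      rw [hk, hp, hF, zero_mul])
  have hFR : ∀ z, p.F (R z) = k (p.F z.1, z.2) := fun z => p.F_lift _ _ _ z
  have hmR : ∀ z, θ₀.map (R z) = θ₀.map z.1 := fun z => p.map_lift _ _ _ z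
  refine isHomotopyEquiv_iff.2 ⟨r, .symm ?_, .symm ?_⟩
  · refine ⟨⟨R.comp ⟨Prod.swap, continuous_swap⟩, fun x => ?_, fun x => ?_⟩⟩
    · exact p.point_ext ((hFR (x, 0)).trans (hk₀ _)) (hmR (x, 0))
    · refine p.point_ext ((hFR (x, 1)).trans (hFr _).symm) ((hmR (x, 1)).trans ?_)
      rw [ContinuousMap.comp_apply, hmr, hF]
  · exact ⟨⟨k.comp ⟨Prod.swap, continuous_swap⟩, hk₀, fun x => (hFr x).symm⟩⟩

/-- The pull-back of a tangential structure along a map of base spaces. -/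
def TangentialStructure.pullback (θ : TangentialStructure d B) (f : C(B', B)) :
    TangentialStructure d B' where
  X := {z : θ.X × B' // (θ.map z.1).2 = f z.2}
  map := ⟨fun z => ((θ.map z.1.1).1, z.1.2), by fun_prop⟩
  fibration := by
    intro Y _ H h₀ hH
    have hH' : ∀ y, ((θ.map (h₀ y).1.1).1, (h₀ y).1.2) = H (y, 0) := hH
    obtain ⟨G, hG, hG₀⟩ := θ.fibration Y ⟨fun z => ((H z).1, f (H z).2), by fun_prop⟩
      ⟨fun y => (h₀ y).1.1, by fun_prop⟩ (fun y => by
        change θ.map (h₀ y).1.1 = ((H (y, 0)).1, f (H (y, 0)).2)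
        rw [← hH' y]
        exact Prod.ext rfl (h₀ y).2)
    refine ⟨⟨fun z => ⟨(G z, (H z).2), by rw [hG]; rfl⟩, by fun_prop⟩, fun z => ?_, fun y => ?_⟩
    · change ((θ.map (G z)).1, (H z).2) = H z
      rw [hG]
      rfl
    · exact Subtype.ext (Prod.ext (hG₀ y) (congrArg (fun w => w.2) (hH' y)).symm)

/-- The canonical square from a pull-back. -/
def PullSquare.ofMap (θ : TangentialStructure d B) (f : C(B', B)) :
    PullSquare (θ.pullback f) θ :=
  .ofLift f ⟨fun z => z.1.1, by fun_prop⟩ (fun z => Prod.ext rfl z.2)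
    (fun _ _ h h' => Subtype.ext (Prod.ext h (congrArg (fun w : BO d × B' => w.2) h')))
    (fun Z _ x y h => ⟨⟨fun z => ⟨(x z, (y z).2), by rw [h]⟩, by fun_prop⟩, fun z => rfl,
      fun z => Prod.ext (congrArg (fun w => w.1) (h z)) rfl⟩)

/-- A square whose base map factors through that of another one factors through that square. -/
theorem PullSquare.exists_factor {B'' : Type u} [TopologicalSpace B'']
    {θ : TangentialStructure d B} {θ' : TangentialStructure d B'} {θ'' : TangentialStructure d B''}
    (p : PullSquare θ' θ) (q : PullSquare θ'' θ) (i : C(B'', B')) (hi : ∀ b, p.f (i b) = q.f b) :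
    ∃ r : PullSquare θ'' θ', r.f = i ∧ r.comp p = q := by
  have h : ∀ x, θ.map (q.F x) = ((θ''.map x).1, p.f (i (θ''.map x).2)) := fun x => by
    rw [q.comm, hi]
  let F := p.lift q.F ⟨fun x => ((θ''.map x).1, i (θ''.map x).2), by fun_prop⟩ h
  have hF : ∀ x, p.F (F x) = q.F x := fun x => p.F_lift _ _ _ x
  have hm : ∀ x, θ'.map (F x) = ((θ''.map x).1, i (θ''.map x).2) := fun x => p.map_lift _ _ _ x
  -- Pasting: the outer and the right square are pull-backs, hence so is the left one.
  refine ⟨.ofLift i F hm (fun x y h₁ h₂ => q.point_ext ?_ h₂) ?_, rfl,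
    PullSquare.ext (ContinuousMap.ext hi) (ContinuousMap.ext hF)⟩
  · rw [← hF, ← hF, h₁]
  · intro Z _ x y hxy
    obtain ⟨l, h₁, h₂⟩ := q.exists_lift (p.F.comp x) y (fun z => by
      rw [ContinuousMap.comp_apply, p.comm, hxy, hi])
    refine ⟨l, fun z => p.point_ext ((hF _).trans (h₁ z)) ?_, h₂⟩
    rw [hm, h₂, hxy]

end Fiberwise

/-! ## A criterion for homotopy invariance -/

section Criterion

variable {d : ℕ} {T : BivariantTheory.{u} d TopCat.{v}}

theorem BivariantTheory.push_homotopic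
    (hpush : ∀ {B : Type u} [TopologicalSpace B] {θ η : TangentialStructure d B}
      {g₀ g₁ : PushMap θ η}, PushHomotopy g₀ g₁ → (T.push g₀).hom.Homotopic (T.push g₁).hom)
    {B : Type u} [TopologicalSpace B] {θ η : TangentialStructure d B} {g₀ g₁ : PushMap θ η}
    (h : PushMap.Homotopic g₀ g₁) : (T.push g₀).hom.Homotopic (T.push g₁).hom := by
  induction h with
  | rel _ _ h => exact hpush h.some
  | refl => exact .refl _
  | symm _ _ _ h => exact h.symm
  | trans _ _ _ _ _ h₁ h₂ => exact h₁.trans h₂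

/-- A fiberwise right inverse `g'` of `g` has in turn a fiberwise right inverse. So the push-forward
along `g'` has inverses on both sides up to homotopy, and the one along `g` follows by two out of
three. -/
theorem BivariantTheory.isHomotopyEquiv_push
    (hpush : ∀ {B : Type u} [TopologicalSpace B] {θ η : TangentialStructure d B}
      {g₀ g₁ : PushMap θ η}, PushHomotopy g₀ g₁ → (T.push g₀).hom.Homotopic (T.push g₁).hom)
    {B : Type u} [TopologicalSpace B] {θ η : TangentialStructure d B} (g : PushMap θ η)
    (hg : IsHomotopyEquiv g.map) : IsHomotopyEquiv (T.push g).hom := by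
  have key : ∀ {θ η : TangentialStructure d B} (g : PushMap θ η) (g' : PushMap η θ),
      PushMap.Homotopic (g'.comp g) (PushMap.id η) →
      ((T.push g).hom.comp (T.push g').hom).Homotopic (.id _) := fun g g' h => by
    have h' := BivariantTheory.push_homotopic hpush h
    rw [T.push_comp, T.push_id] at h'
    exact h'
  obtain ⟨g', hg', h⟩ := g.exists_right_inverse hg
  obtain ⟨g'', -, h'⟩ := g'.exists_right_inverse hg'
  exact isHomotopyEquiv_of_comp_right (isHomotopyEquiv_of_inverses (key _ _ h) (key _ _ h'))
    (isHomotopyEquiv_of_homotopic (key _ _ h).symm isHomotopyEquiv_id)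

/-- The inverse is the pull-back along the projection: one composite comes from the contraction of
`[0, 1]`, the other from the identity square. -/
theorem BivariantTheory.isHomotopyEquiv_pull_incl
    (hcontract : ∀ {B : Type u} [TopologicalSpace B] (θ : TangentialStructure d B),
      (T.pull ((PullSquare.proj θ).comp (PullSquare.incl θ 0))).hom.Homotopic
        (T.pull (PullSquare.id (θ.prodTop unitInterval))).hom)
    {B : Type u} [TopologicalSpace B] (θ : TangentialStructure d B) :
    IsHomotopyEquiv (T.pull (PullSquare.incl θ 0)).hom := by
  refine isHomotopyEquiv_iff.2 ⟨(T.pull (PullSquare.proj θ)).hom, ?_, ?_⟩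
  · have h := hcontract θ
    rw [T.pull_comp, T.pull_id] at h
    exact h
  · have h : T.pull (PullSquare.proj θ) ≫ T.pull (PullSquare.incl θ 0) = 𝟙 _ := by
      rw [← T.pull_comp, ← T.pull_id]
      rfl
    have h' := congrArg TopCat.Hom.hom h
    rw [TopCat.hom_comp] at h'
    rw [h']
    exact .refl _

/-- Lifting the identity of `B × [0, 1]` as a homotopy that starts at `p.F` gives a fiberwise map
`g` from `θ₀ × [0, 1]` to `θ`. Both total spaces contain `θ₀.X` as an equivalence, so `g` is an
equivalence; as push and pull commute, the claim reduces to the product case. -/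
theorem BivariantTheory.isHomotopyEquiv_pull_of_zero
    (hpush : ∀ {B : Type u} [TopologicalSpace B] {θ η : TangentialStructure d B}
      {g₀ g₁ : PushMap θ η}, PushHomotopy g₀ g₁ → (T.push g₀).hom.Homotopic (T.push g₁).hom)
    (hcontract : ∀ {B : Type u} [TopologicalSpace B] (θ : TangentialStructure d B),
      (T.pull ((PullSquare.proj θ).comp (PullSquare.incl θ 0))).hom.Homotopic
        (T.pull (PullSquare.id (θ.prodTop unitInterval))).hom)
    {B : Type u} [TopologicalSpace B] {θ : TangentialStructure d (B × unitInterval)}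
    {θ₀ : TangentialStructure d B} (p : PullSquare θ₀ θ) (hp : ∀ b, p.f b = (b, 0)) :
    IsHomotopyEquiv (T.pull p).hom := by
  obtain ⟨G, hG, hG₀⟩ := θ.fibration θ₀.X
    ⟨fun z => ((θ₀.map z.1).1, (θ₀.map z.1).2, z.2), by fun_prop⟩ p.F
    (fun x => by
      change θ.map (p.F x) = ((θ₀.map x).1, (θ₀.map x).2, 0)
      rw [p.comm, hp])
  let g : PushMap (θ₀.prodTop unitInterval) θ := ⟨G, hG⟩
  have hincl : IsHomotopyEquiv (PullSquare.incl θ₀ 0).F :=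
    (PullSquare.incl θ₀ 0).isHomotopyEquiv_F_of_zero fun _ => rfl
  have hg : IsHomotopyEquiv g.map := by
    refine isHomotopyEquiv_of_comp_right hincl ?_
    rw [show g.map.comp (PullSquare.incl θ₀ 0).F = p.F from ContinuousMap.ext hG₀]
    exact p.isHomotopyEquiv_F_of_zero hp
  have h := T.push_pull (PullSquare.incl θ₀ 0) p g (PushMap.id θ₀)
    (ContinuousMap.ext fun b => (hp b).symm) (ContinuousMap.ext fun x => (hG₀ x).symm)
  rw [T.push_id, Category.comp_id] at h
  have h' := congrArg TopCat.Hom.hom h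
  rw [TopCat.hom_comp] at h'
  refine isHomotopyEquiv_of_comp_right (BivariantTheory.isHomotopyEquiv_push hpush g hg) ?_
  rw [h']
  exact BivariantTheory.isHomotopyEquiv_pull_incl hcontract θ₀

/-- The reversal of `[0, 1]` exchanges the two ends. It is an involution, so factoring identity
squares twice gives the pull-back along `ρ'` inverses on both sides. -/
theorem BivariantTheory.isHomotopyEquiv_pull_of_one
    (hpush : ∀ {B : Type u} [TopologicalSpace B] {θ η : TangentialStructure d B}
      {g₀ g₁ : PushMap θ η}, PushHomotopy g₀ g₁ → (T.push g₀).hom.Homotopic (T.push g₁).hom)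
    (hcontract : ∀ {B : Type u} [TopologicalSpace B] (θ : TangentialStructure d B),
      (T.pull ((PullSquare.proj θ).comp (PullSquare.incl θ 0))).hom.Homotopic
        (T.pull (PullSquare.id (θ.prodTop unitInterval))).hom)
    {B : Type u} [TopologicalSpace B] {θ : TangentialStructure d (B × unitInterval)}
    {θ₁ : TangentialStructure d B} (p : PullSquare θ₁ θ) (hp : ∀ b, p.f b = (b, 1)) :
    IsHomotopyEquiv (T.pull p).hom := by
  let s : C(B × unitInterval, B × unitInterval) :=
    ⟨fun z => (z.1, unitInterval.symm z.2), by fun_prop⟩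
  have hs : ∀ z, s (s z) = z := fun z => Prod.ext rfl (unitInterval.symm_symm z.2)
  let ρ := PullSquare.ofMap θ s
  obtain ⟨ρ', hρ', hid⟩ := ρ.exists_factor (PullSquare.id θ) s hs
  obtain ⟨ρ'', -, hid'⟩ := ρ'.exists_factor (PullSquare.id _) s
    (fun z => by rw [hρ']; exact hs z)
  have e₁ : T.pull ρ ≫ T.pull ρ' = 𝟙 _ := by rw [← T.pull_comp, hid, T.pull_id]
  have e₂ : T.pull ρ' ≫ T.pull ρ'' = 𝟙 _ := by rw [← T.pull_comp, hid', T.pull_id]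
  have e₁' := congrArg TopCat.Hom.hom e₁
  have e₂' := congrArg TopCat.Hom.hom e₂
  rw [TopCat.hom_comp, TopCat.hom_id] at e₁' e₂'
  have hρ : IsHomotopyEquiv (T.pull ρ').hom := by
    refine isHomotopyEquiv_of_inverses (g := (T.pull ρ'').hom) (g' := (T.pull ρ).hom) ?_ ?_
    · rw [e₂']
    · rw [e₁']
  have h₀ := BivariantTheory.isHomotopyEquiv_pull_of_zero hpush hcontract (p.comp ρ') (fun b => by
    change ρ'.f (p.f b) = _
    rw [hρ', hp]
    exact Prod.ext rfl unitInterval.symm_one)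
  rw [T.pull_comp, TopCat.hom_comp] at h₀
  exact isHomotopyEquiv_of_comp_right hρ h₀

/-- Pull-backs along homotopic maps are simultaneously homotopy equivalences. -/
theorem BivariantTheory.isHomotopyEquiv_pull_of_homotopic
    (hpush : ∀ {B : Type u} [TopologicalSpace B] {θ η : TangentialStructure d B}
      {g₀ g₁ : PushMap θ η}, PushHomotopy g₀ g₁ → (T.push g₀).hom.Homotopic (T.push g₁).hom)
    (hcontract : ∀ {B : Type u} [TopologicalSpace B] (θ : TangentialStructure d B),
      (T.pull ((PullSquare.proj θ).comp (PullSquare.incl θ 0))).hom.Homotopic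
        (T.pull (PullSquare.id (θ.prodTop unitInterval))).hom)
    {B B' : Type u} [TopologicalSpace B] [TopologicalSpace B'] {θ : TangentialStructure d B}
    {θ₀ θ₁ : TangentialStructure d B'} (p₀ : PullSquare θ₀ θ) (p₁ : PullSquare θ₁ θ)
    (h : p₀.f.Homotopic p₁.f) (h₁ : IsHomotopyEquiv (T.pull p₁).hom) :
    IsHomotopyEquiv (T.pull p₀).hom := by
  obtain ⟨H⟩ := h
  -- Both `p₀` and `p₁` factor through the pull-back along the homotopy, over the two ends of `B' ×
  -- [0, 1]`, and restriction to either end is an equivalence.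
  let P := PullSquare.ofMap θ (B' := B' × unitInterval) ⟨fun z => H (z.2, z.1), by fun_prop⟩
  obtain ⟨q₀, hq₀, e₀⟩ := P.exists_factor p₀ ⟨fun b => (b, 0), by fun_prop⟩ H.apply_zero
  obtain ⟨q₁, hq₁, e₁⟩ := P.exists_factor p₁ ⟨fun b => (b, 1), by fun_prop⟩ H.apply_one
  have k₀ := BivariantTheory.isHomotopyEquiv_pull_of_zero hpush hcontract q₀
    (fun b => by rw [hq₀]; rfl)
  have k₁ := BivariantTheory.isHomotopyEquiv_pull_of_one hpush hcontract q₁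
    (fun b => by rw [hq₁]; rfl)
  rw [← e₁, T.pull_comp, TopCat.hom_comp] at h₁
  rw [← e₀, T.pull_comp, TopCat.hom_comp]
  exact isHomotopyEquiv_comp (isHomotopyEquiv_of_comp_left k₁ h₁) k₀

/-- A bivariant theory is homotopy invariant if it takes fiberwise homotopic maps to homotopic
maps and if the contraction of `[0, 1]` acts on it up to homotopy as the identity. -/
theorem BivariantTheory.isHomotopyInvariant_of_homotopies
    (hpush : ∀ {B : Type u} [TopologicalSpace B] {θ η : TangentialStructure d B}
      {g₀ g₁ : PushMap θ η}, PushHomotopy g₀ g₁ → (T.push g₀).hom.Homotopic (T.push g₁).hom)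
    (hcontract : ∀ {B : Type u} [TopologicalSpace B] (θ : TangentialStructure d B),
      (T.pull ((PullSquare.proj θ).comp (PullSquare.incl θ 0))).hom.Homotopic
        (T.pull (PullSquare.id (θ.prodTop unitInterval))).hom) :
    T.IsHomotopyInvariant where
  push g hg := BivariantTheory.isHomotopyEquiv_push hpush g hg
  pull {B' B _ _ θ' θ} p hp := by
    have hid : ∀ {B : Type u} [TopologicalSpace B] (θ : TangentialStructure d B),
        IsHomotopyEquiv (T.pull (PullSquare.id θ)).hom := fun θ => by
      rw [T.pull_id]
      exact isHomotopyEquiv_id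
    obtain ⟨e, h₁, h₂⟩ := isHomotopyEquiv_iff.1 hp
    -- The square `q.comp p` lies over `p.f ∘ e`, which is only homotopic to the identity, so its
    -- source need not be `θ` and `q` gives no direct inverse. A further pull-back `r` gives a
    -- second composite `r.comp q`, over `e ∘ p.f`, and two out of six applies.
    let q := PullSquare.ofMap θ' e
    let r := PullSquare.ofMap (θ'.pullback e) p.f
    have k₁ := BivariantTheory.isHomotopyEquiv_pull_of_homotopic hpush hcontract (q.comp p)
      (PullSquare.id θ) h₂ (hid θ)
    have k₂ := BivariantTheory.isHomotopyEquiv_pull_of_homotopic hpush hcontract (r.comp q)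
      (PullSquare.id θ') h₁ (hid θ')
    rw [T.pull_comp, TopCat.hom_comp] at k₁ k₂
    exact isHomotopyEquiv_of_two_out_of_six k₁ k₂

end Criterion

/-- The realization of the simplicial thickening of a bivariant theory is homotopy invariant. -/
theorem BivariantTheory.realization_isHomotopyInvariant {d : ℕ}
    (F : BivariantTheory.{u} d TopCat.{v}) : F.realization.IsHomotopyInvariant :=
  BivariantTheory.isHomotopyInvariant_of_homotopies F.realization_push_homotopic
    F.realization_contract_homotopic

end ParamCob
end

theorem proposition2p4 (d : ℕ) [NeZero d] :
    (ParamCob.cobordismSpaceTheory.{u} d).IsHomotopyInvariant := by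
  have h := ((ParamCob.cobordismTheory.{u} d).postcomp
    ParamCob.classifyingSpace).realization_isHomotopyInvariant
  -- Applying the classifying space degreewise to the thickening of `C` agrees by definition with
  -- thickening the composite theory.
  exact ⟨fun g hg => h.push g hg, fun p hp => h.pull p hp⟩
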